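/- Let $V\subset\mathbb{R}$ be a set of $n$ points, regarded as labelled, and let the $\binom n2$ pairwise distances of $V$ be revealed one by one in a uniformly random order; for $0\le t\le\binom n2$ let $G_t$ be the graph on $V$ whose edges are the pairs whose distances are among the first $t$ revealed. Say that $V$ is *reconstructible* at time $t$ if the revealed distances determine the positions of the labelled points up to isometry: for every injective map $f\colon V\to\mathbb{R}$ with $|f(u)-f(v)|=|u-v|$ for all edges $uv$ of $G_t$, there is an isometry $g$ of $\mathbb{R}$ with $f(u)=g(u)$ for all $u\in V$. Call an ordered pair $(u,v)$ of distinct points of $V$ *secure* if the reflection $2v-u$ of $u$ over $v$ also lies in $V$. Then, with probability tending to $1$ as $n\to\infty$, uniformly over all $n$-point sets $V\subset\mathbb{R}$, the first time $t$ at which $V$ is reconstructible exists and is exactly the first time $t$ at which both of the following hold: (i) every point of $V$ is incident to at least one edge of $G_t$ (has at least one revealed distance); (ii) whenever a point $u\in V$ is incident to exactly one edge of $G_t$, say $uv$, the pair $(u,v)$ is secure. -/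

import Mathlib

namespace LineReconstruction

/-- The point set `V`, with its points labelled, is reconstructible from the distances between the
pairs of points that are adjacent in `G`: every placement of the labelled points at distinct
positions of the line which agrees with the known distances is the true one up to an isometry. -/
def Reconstructible (V : Finset ℝ) (G : SimpleGraph V) : Prop :=
  ∀ f : V → ℝ, Function.Injective f →
    (∀ u v : V, G.Adj u v → dist (f u) (f v) = dist (u : ℝ) (v : ℝ)) →
    ∃ g : ℝ ≃ᵢ ℝ, ∀ u : V, f u = g u

/-- The ordered pair `(u, v)` of distinct points of `V` is secure if the reflection `2v - u` of `u`
over `v` is also in `V`. -/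
def Secure (V : Finset ℝ) (u v : V) : Prop :=
  u ≠ v ∧ 2 * (v : ℝ) - (u : ℝ) ∈ V

/-- Every point is incident to at least one revealed distance, and if a point `u` is incident to
exactly one revealed distance, which is to `v`, then `(u, v)` is secure. -/
def NoIsolatedNoUndecidable (V : Finset ℝ) (G : SimpleGraph V) : Prop :=
  (∀ u : V, (G.neighborSet u).Nonempty) ∧
    ∀ u v : V, G.neighborSet u = {v} → Secure V u v

/-- An order in which the `n.choose 2` pairwise distances of the `n`-point set `V` are revealed. -/
abbrev RevealOrder (V : Finset ℝ) : Type :=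
  Fin (V.card.choose 2) ≃ (⊤ : SimpleGraph V).edgeSet

instance (V : Finset ℝ) : MeasurableSpace (RevealOrder V) := ⊤

/-- The graph of the first `t` revealed distances
(the complete graph as soon as `t` is at least `V.card.choose 2`). -/
def revealedGraph {V : Finset ℝ} (σ : RevealOrder V) (t : ℕ) : SimpleGraph V :=
  SimpleGraph.fromEdgeSet {e | ∃ i : Fin (V.card.choose 2), (i : ℕ) < t ∧ (σ i : Sym2 V) = e}

end LineReconstruction

/-!
If a placement `f` agrees with the known distances, each edge preserves `f u - u` or `f u + u`. When
any two large sets of points are joined by an edge, this forces one of the two functions to be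
constant on all but few points, so after an isometry `f` fixes all but few points. The moved points
span a sparse graph, and a moved point has at most one fixed neighbour, over which it is reflected;
this leads to moved points of low degree. Low-degree points are too rare to be adjacent, to have a
common neighbour, or to be reflected to each other over a neighbour. Hence every moved point `u` has
low degree and a single neighbour `v`, which is fixed. If `(u, v)` were secure, the point
`2 * v - u` of `V`, whose place is taken by `u`, would have moved as well, and so would have low
degree.

The first time without isolated or undecidable points lies between `(1 / 3) n log n` and `n log n`:
the last isolated points and the last points of degree `1` disappear at about `(1 / 2) n log n`. Two
given points have low degree with probability `n ^ (-c)` for some `c > 1` as soon as the time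
exceeds `(1 / 4) n log n`, so the rare configurations above are absent between these two times.
-/

namespace LineReconstruction

open Finset MeasureTheory ProbabilityTheory

section LargeSets

variable {ι α β : Type*}

lemma exists_balanced_preimage [Fintype ι] [DecidableEq α] (a : ι → α) {x : ℝ} (hx0 : 0 < x)
    (hx : 3 * x ≤ Fintype.card ι) (ha : ∀ c, (#{i | a i = c} : ℝ) ≤ Fintype.card ι - x) :
    ∃ T : Finset α, x ≤ #{i | a i ∈ T} ∧ x ≤ #{i | a i ∉ T} := by
  classical
  have card_add (T : Finset α) : (#{i | a i ∈ T} : ℝ) + #{i | a i ∉ T} = Fintype.card ι := by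
    exact_mod_cast card_filter_add_card_filter_not (s := (univ : Finset ι)) fun i => a i ∈ T
  by_cases hlarge : ∃ c, x ≤ #{i | a i = c}
  · obtain ⟨c, hc⟩ := hlarge
    have hsum := card_add {c}
    simp only [mem_singleton] at hsum
    exact ⟨{c}, by simpa only [mem_singleton] using hc, by
      simp only [mem_singleton]; linarith [ha c]⟩
  push Not at hlarge
  suffices ∃ T : Finset α, x ≤ #{i | a i ∈ T} ∧ (#{i | a i ∈ T} : ℝ) < 2 * x by
    obtain ⟨T, hxT, hTx⟩ := this
    exact ⟨T, hxT, by linarith [card_add T]⟩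
  by_contra! hjump
  have hsmall (T : Finset α) : (#{i | a i ∈ T} : ℝ) < x := by
    induction T using Finset.induction_on with
    | empty => simpa using hx0
    | insert c T _ ih =>
      by_contra! hge
      have hle : (#{i | a i ∈ insert c T} : ℝ) ≤ #{i | a i = c} + #{i | a i ∈ T} := by
        have hsub : univ.filter (a · ∈ insert c T) ⊆
            univ.filter (a · = c) ∪ univ.filter (a · ∈ T) := fun i => by simp
        exact_mod_cast (card_le_card hsub).trans (card_union_le _ _)
      linarith [hjump _ hge, hlarge c]
  have huniv := hsmall (univ.image a)
  simp only [mem_image_of_mem a (mem_univ _), filter_true, card_univ] at huniv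
  linarith

/-- Any two disjoint sets of at least `x` vertices are joined by an edge. -/
def LargeSetsJoined (G : SimpleGraph ι) (x : ℝ) : Prop :=
  ∀ A B : Finset ι, Disjoint A B → x ≤ #A → x ≤ #B → ∃ u ∈ A, ∃ v ∈ B, G.Adj u v

/-- Every nonempty set of at most `y` vertices has a member with at most `d` neighbours in it. -/
def SmallSetsSparse (G : SimpleGraph ι) (y d : ℝ) : Prop :=
  ∀ L : Finset ι, L.Nonempty → #L ≤ y → ∃ u ∈ L, ((G.neighborSet u ∩ L).ncard : ℝ) ≤ d

lemma LargeSetsJoined.mono {G G' : SimpleGraph ι} {x : ℝ} (h : LargeSetsJoined G x)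
    (hG : G ≤ G') : LargeSetsJoined G' x := by
  intro A B hAB hA hB
  obtain ⟨u, hu, v, hv, huv⟩ := h A B hAB hA hB
  exact ⟨u, hu, v, hv, hG huv⟩

lemma SmallSetsSparse.anti {G G' : SimpleGraph ι} {y d : ℝ} (h : SmallSetsSparse G y d)
    (hG : G' ≤ G) : SmallSetsSparse G' y d := by
  intro L hL hLy
  obtain ⟨u, hu, hud⟩ := h L hL hLy
  have hsub : G'.neighborSet u ∩ L ⊆ G.neighborSet u ∩ L :=
    Set.inter_subset_inter_left _ fun v huv => hG huv
  exact ⟨u, hu, le_trans (by exact_mod_cast Set.ncard_le_ncard hsub) hud⟩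

lemma LargeSetsJoined.exists_dominant_fibre [Fintype ι] [DecidableEq α] [DecidableEq β]
    {G : SimpleGraph ι} {x : ℝ} (hG : LargeSetsJoined G x) (hx0 : 0 < x)
    (hx : 6 * x ≤ Fintype.card ι) {a : ι → α} {b : ι → β}
    (hab : ∀ u v, G.Adj u v → a u = a v ∨ b u = b v) :
    (∃ c, (Fintype.card ι - 2 * x : ℝ) < #{i | a i = c}) ∨
      ∃ c, (Fintype.card ι - 2 * x : ℝ) < #{i | b i = c} := by
  by_contra! hcon
  obtain ⟨S, hS, hS'⟩ := exists_balanced_preimage a (by linarith) (by linarith) hcon.1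
  obtain ⟨T, hT, hT'⟩ := exists_balanced_preimage b (by linarith) (by linarith) hcon.2
  -- No edge joins diagonally opposite cells of the partition into four cells cut out by `S`, `T`,
  -- so on each diagonal one of the cells is small.
  have hdiag (P Q : Finset ι)
      (hPQ : ∀ u ∈ P, ∀ v ∈ Q, ¬ (a u ∈ S ↔ a v ∈ S) ∧ ¬ (b u ∈ T ↔ b v ∈ T)) :
      (#P : ℝ) < x ∨ (#Q : ℝ) < x := by
    by_contra! hlarge
    obtain ⟨u, hu, v, hv, huv⟩ := hG P Q
      (disjoint_left.2 fun u hu hu' => (hPQ u hu u hu').1 Iff.rfl) hlarge.1 hlarge.2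
    rcases hab u v huv with h | h
    · exact (hPQ u hu v hv).1 (by rw [h])
    · exact (hPQ u hu v hv).2 (by rw [h])
  have hsplit (p q : ι → Prop) [DecidablePred p] [DecidablePred q] :
      (#{i | p i} : ℝ) = #{i | p i ∧ q i} + #{i | p i ∧ ¬ q i} := by
    rw [← filter_filter, ← filter_filter]
    exact_mod_cast (card_filter_add_card_filter_not (s := {i | p i}) q).symm
  have hSsplit := hsplit (fun i => a i ∈ S) (fun i => b i ∈ T)
  have hScsplit := hsplit (fun i => a i ∉ S) (fun i => b i ∈ T)
  have hTsplit := hsplit (fun i => b i ∈ T) (fun i => a i ∈ S)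
  have hTcsplit := hsplit (fun i => b i ∉ T) (fun i => a i ∈ S)
  simp only [and_comm (a := b _ ∈ T), and_comm (a := b _ ∉ T)] at hTsplit hTcsplit
  rcases hdiag {i | a i ∈ S ∧ b i ∈ T} {i | a i ∉ S ∧ b i ∉ T}
    (by simp only [mem_filter_univ]; tauto) with h₁ | h₁ <;>
  rcases hdiag {i | a i ∈ S ∧ b i ∉ T} {i | a i ∉ S ∧ b i ∈ T}
    (by simp only [mem_filter_univ]; tauto) with h₂ | h₂ <;>
  linarith

end LargeSets

section Reconstruction

/-- The set of vertices of degree at most `k`; the threshold is real to avoid roundings. -/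
def lowDegree {ι : Type*} (G : SimpleGraph ι) (k : ℝ) : Set ι :=
  {u | ((G.neighborSet u).ncard : ℝ) ≤ k}

lemma lowDegree_anti {ι : Type*} [Finite ι] {G G' : SimpleGraph ι} (h : G ≤ G') (k : ℝ) :
    lowDegree G' k ⊆ lowDegree G k := by
  intro u (hu : ((G'.neighborSet u).ncard : ℝ) ≤ k)
  have hsub : G.neighborSet u ⊆ G'.neighborSet u := fun v huv => h huv
  exact le_trans (by exact_mod_cast Set.ncard_le_ncard hsub) hu

/-- No neighbour `v` of a point `u` of `S` reflects `u` to a point of `S`. -/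
def ReflectionFree {V : Finset ℝ} (G : SimpleGraph V) (S : Set V) : Prop :=
  ∀ u ∈ S, ∀ w ∈ S, ∀ v, G.Adj u v → (w : ℝ) ≠ 2 * v - u

/-- The properties of the known distances from which reconstruction is deduced. The lower bounds on
the graph are required of `G` and the upper bounds of `H`, so that they extend to all graphs between
`G` and `H`. -/
structure Pseudorandom (V : Finset ℝ) (G H : SimpleGraph V) (x d : ℝ) : Prop where
  joined : LargeSetsJoined G x
  sparse : SmallSetsSparse H (2 * x) d
  isIndepSet : H.IsIndepSet (lowDegree G (d + 2))
  disjoint : (lowDegree G (d + 2)).PairwiseDisjoint H.neighborSet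
  reflectionFree : ReflectionFree H (lowDegree G (d + 2))

variable {V : Finset ℝ} {G H : SimpleGraph V} {x d : ℝ}

lemma Pseudorandom.mono {G' H' : SimpleGraph V} (h : Pseudorandom V G H x d) (hG : G ≤ G')
    (hH : H' ≤ H) : Pseudorandom V G' H' x d where
  joined := h.joined.mono hG
  sparse := h.sparse.anti hH
  isIndepSet := (h.isIndepSet.mono (lowDegree_anti hG _)).imp fun _ _ hadj hadj' => hadj (hH hadj')
  disjoint := (h.disjoint.subset (lowDegree_anti hG _)).mono_on fun _ _ _ hv => hH hv
  reflectionFree u hu w hw v huv :=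
    h.reflectionFree u (lowDegree_anti hG _ hu) w (lowDegree_anti hG _ hw) v (hH huv)

/-- `f` preserves the known distances. -/
def PreservesDist (G : SimpleGraph V) (f : V → ℝ) : Prop :=
  ∀ u v : V, G.Adj u v → dist (f u) (f v) = dist (u : ℝ) (v : ℝ)

namespace PreservesDist

variable {f : V → ℝ}

lemma eq_reflection (hd : PreservesDist G f) {u v : V} (huv : G.Adj u v) (hu : f u ≠ u)
    (hv : f v = v) : f u = 2 * v - u := by
  have h := hd u v huv
  rw [Real.dist_eq, Real.dist_eq, hv, abs_eq_abs] at h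
  rcases h with h | h
  · exact absurd (by linarith) hu
  · linarith

lemma fixed_neighbor_unique (hd : PreservesDist G f) {u v w : V} (hu : f u ≠ u)
    (huv : G.Adj u v) (hv : f v = v) (huw : G.Adj u w) (hw : f w = w) : v = w :=
  Subtype.ext (by linarith [hd.eq_reflection huv hu hv, hd.eq_reflection huw hu hw])

lemma ncard_neighborSet_le (hd : PreservesDist G f) {S : Set V}
    (hS : S.PairwiseDisjoint G.neighborSet) {v : V} (hv : f v ≠ v) :
    (G.neighborSet v).ncard ≤ (G.neighborSet v ∩ {w | f w ≠ w ∧ w ∉ S}).ncard + 2 := by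
  have hfixed : {w | G.Adj v w ∧ f w = w}.ncard ≤ 1 := (Set.ncard_le_one_iff).2 fun hw hw' =>
    hd.fixed_neighbor_unique hv hw.1 hw.2 hw'.1 hw'.2
  have hS_le : {w | G.Adj v w ∧ w ∈ S}.ncard ≤ 1 := (Set.ncard_le_one_iff).2 fun hw hw' => by
    by_contra hne
    exact Set.disjoint_left.1 (hS hw.2 hw'.2 hne) hw.1.symm hw'.1.symm
  have hcover : G.neighborSet v ⊆ (G.neighborSet v ∩ {w | f w ≠ w ∧ w ∉ S}) ∪
      ({w | G.Adj v w ∧ f w = w} ∪ {w | G.Adj v w ∧ w ∈ S}) := by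
    intro w (hw : G.Adj v w)
    simp only [Set.mem_union, Set.mem_inter_iff, SimpleGraph.mem_neighborSet, Set.mem_ofPred_eq]
    tauto
  have h₁ := (Set.ncard_le_ncard hcover).trans (Set.ncard_union_le _ _)
  have h₂ := Set.ncard_union_le {w | G.Adj v w ∧ f w = w} {w | G.Adj v w ∧ w ∈ S}
  omega

lemma mem_lowDegree_of_ne (hd : PreservesDist G f) (hG : Pseudorandom V G G x d)
    (hbig : (Fintype.card V - 2 * x : ℝ) < #{u : V | f u = u}) {u : V} (hu : f u ≠ u) :
    u ∈ lowDegree G (d + 2) := by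
  classical
  set S := lowDegree G (d + 2)
  by_contra huS
  set L : Finset V := {v | f v ≠ v ∧ v ∉ S} with hL
  have hcard : #L ≤ 2 * x := by
    have hsum : (#{u : V | f u = u} : ℝ) + #{u : V | f u ≠ u} = Fintype.card V := by
      exact_mod_cast card_filter_add_card_filter_not (s := (univ : Finset V)) fun u => f u = u
    have hle : (#L : ℝ) ≤ #{u : V | f u ≠ u} := by
      rw [hL]
      gcongr with u
      exact And.left
    linarith
  obtain ⟨v, hv, hvd⟩ := hG.sparse L ⟨u, by simpa [hL] using ⟨hu, huS⟩⟩ hcard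
  obtain ⟨hvf, hvS⟩ : f v ≠ v ∧ v ∉ S := by simpa [hL] using hv
  rw [show (L : Set V) = {w | f w ≠ w ∧ w ∉ S} by simp [hL]] at hvd
  have hdeg : ((G.neighborSet v).ncard : ℝ) ≤
      (G.neighborSet v ∩ {w | f w ≠ w ∧ w ∉ S}).ncard + 2 := by
    exact_mod_cast hd.ncard_neighborSet_le hG.disjoint hvf
  exact hvS (show ((G.neighborSet v).ncard : ℝ) ≤ d + 2 by linarith)

lemma eq_self (hd : PreservesDist G f) (hf : Function.Injective f) (hG : Pseudorandom V G G x d)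
    (hN : NoIsolatedNoUndecidable V G)
    (hbig : (Fintype.card V - 2 * x : ℝ) < #{u : V | f u = u}) (u : V) : f u = u := by
  have hlow {w : V} (hw : f w ≠ w) := hd.mem_lowDegree_of_ne hG hbig hw
  by_contra hu
  have hfix {v : V} (huv : G.Adj u v) : f v = v := by
    by_contra hv
    exact hG.isIndepSet (hlow hu) (hlow hv) huv.ne huv
  obtain ⟨v, huv⟩ : ∃ v, G.Adj u v := hN.1 u
  have hleaf : G.neighborSet u = {v} := Set.eq_singleton_iff_unique_mem.2
    ⟨huv, fun w huw => hd.fixed_neighbor_unique hu huw (hfix huw) huv (hfix huv)⟩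
  obtain ⟨-, hmem⟩ := hN.2 u v hleaf
  have hfu : f u = 2 * v - u := hd.eq_reflection huv hu (hfix huv)
  have hw : f ⟨_, hmem⟩ ≠ 2 * (v : ℝ) - u := fun hw => hu <| by
    rw [hfu]
    exact (congrArg Subtype.val (hf (hfu.trans hw.symm))).symm
  exact hG.reflectionFree u (hlow hu) ⟨_, hmem⟩ (hlow hw) v huv rfl

end PreservesDist

theorem Pseudorandom.reconstructible (hG : Pseudorandom V G G x d) (hx0 : 0 < x)
    (hx : 6 * x ≤ V.card) (hN : NoIsolatedNoUndecidable V G) : Reconstructible V G := by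
  intro f hf hd
  have hsign (u v : V) (huv : G.Adj u v) : f u - u = f v - v ∨ f u + u = f v + v := by
    have h := hd u v huv
    rw [Real.dist_eq, Real.dist_eq, abs_eq_abs] at h
    exact h.imp (fun h => by linarith) fun h => by linarith
  rcases hG.joined.exists_dominant_fibre hx0 (by simpa using hx) hsign with ⟨c, hc⟩ | ⟨c, hc⟩
  · have hd' : PreservesDist G fun u => f u - c := fun u v huv => by
      simpa using hd u v huv
    refine ⟨IsometryEquiv.addRight c, fun u => sub_eq_iff_eq_add.1 ?_⟩
    exact hd'.eq_self ((sub_left_injective (b := c)).comp hf) hG hN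
      (by simpa only [sub_eq_iff_eq_add, add_comm] using hc) u
  · have hd' : PreservesDist G fun u => c - f u := fun u v huv => by
      rw [dist_sub_left, hd u v huv]
    refine ⟨IsometryEquiv.subLeft c, fun u => ?_⟩
    have h := hd'.eq_self ((sub_right_injective (b := c)).comp hf) hG hN
      (by simpa only [sub_eq_iff_eq_add', eq_comm (a := c)] using hc) u
    simp only [IsometryEquiv.subLeft_apply]
    linarith

lemma exists_ne_ne (hV : 3 ≤ V.card) (u v : V) : ∃ w : V, w ≠ u ∧ w ≠ v := by
  obtain ⟨w, hw⟩ : (({u, v} : Finset V)ᶜ).Nonempty := by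
    rw [← card_pos, card_compl, Fintype.card_coe]
    have := card_le_two (a := u) (b := v)
    omega
  exact ⟨w, by simpa using hw⟩

lemma Reconstructible.eq_reflection (hG : Reconstructible V G) {u v : V} (hvu : v ≠ u) {y : ℝ}
    (hy : y ∉ V) (hdist : ∀ w, G.Adj u w → dist y (w : ℝ) = dist (u : ℝ) w) :
    y = 2 * v - u := by
  have hinj : Function.Injective (Function.update (fun v : V => (v : ℝ)) u y) := by
    intro a b hab
    by_cases ha : a = u <;> by_cases hb : b = u
    · rw [ha, hb]
    · subst ha
      rw [Function.update_self, Function.update_of_ne hb] at hab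
      exact absurd (hab ▸ b.2) hy
    · subst hb
      rw [Function.update_self, Function.update_of_ne ha] at hab
      exact absurd (hab ▸ a.2) hy
    · rw [Function.update_of_ne ha, Function.update_of_ne hb] at hab
      exact Subtype.ext hab
  obtain ⟨g, hg⟩ := hG _ hinj fun a b hab => by
    by_cases ha : a = u
    · subst ha
      rw [Function.update_self, Function.update_of_ne hab.ne', hdist b hab]
    by_cases hb : b = u
    · subst hb
      rw [Function.update_self, Function.update_of_ne ha, dist_comm, hdist a hab.symm, dist_comm]
    rw [Function.update_of_ne ha, Function.update_of_ne hb]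
  have hgu : y = g u := by simpa using hg u
  have hgv : (v : ℝ) = g v := by simpa [hvu] using hg v
  have h := g.isometry.dist_eq (u : ℝ) v
  rw [← hgu, ← hgv, Real.dist_eq, Real.dist_eq, abs_eq_abs] at h
  rcases h with h | h
  · exact absurd (by rw [show y = u by linarith]; exact u.2) hy
  · linarith

theorem Reconstructible.noIsolatedNoUndecidable (hG : Reconstructible V G) (hV : 3 ≤ V.card) :
    NoIsolatedNoUndecidable V G := by
  constructor
  · intro u
    by_contra hne
    obtain ⟨v, hv, -⟩ := exists_ne_ne hV u u
    obtain ⟨y, hy⟩ := Infinite.exists_notMem_finset (insert (2 * (v : ℝ) - u) V)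
    rw [mem_insert, not_or] at hy
    exact hy.1 (hG.eq_reflection hv hy.2 fun w huw => absurd ⟨w, huw⟩ hne)
  · intro u v huv
    have hadj : v ∈ G.neighborSet u := huv ▸ rfl
    refine ⟨hadj.ne, ?_⟩
    by_contra hmem
    obtain ⟨w, hwu, hwv⟩ := exists_ne_ne hV u v
    have hw := hG.eq_reflection hwu hmem fun z hz => by
      obtain rfl : z = v := by simpa [huv] using (show z ∈ G.neighborSet u from hz)
      rw [Real.dist_eq, Real.dist_eq, abs_eq_abs]
      right
      ring
    exact hwv (Subtype.ext (by linarith))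

/-- The first time at which no point is isolated or undecidable and the first time at which the
point set is reconstructible both exist and are equal. -/
def HittingTimesAgree (σ : RevealOrder V) : Prop :=
  ∃ t : ℕ, IsLeast {s : ℕ | NoIsolatedNoUndecidable V (revealedGraph σ s)} t ∧
    IsLeast {s : ℕ | Reconstructible V (revealedGraph σ s)} t

lemma revealedGraph_mono (σ : RevealOrder V) : Monotone (revealedGraph σ) := fun _ _ hst =>
  SimpleGraph.fromEdgeSet_mono fun _ ⟨i, hi, he⟩ => ⟨i, hi.trans_le hst, he⟩

lemma noIsolatedNoUndecidable_of_lowDegree_eq_empty (hG : lowDegree G 1 = ∅) :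
    NoIsolatedNoUndecidable V G := by
  have hdeg (u : V) : 1 < (G.neighborSet u).ncard := by
    by_contra! hle
    have hu : u ∈ lowDegree G 1 := show ((G.neighborSet u).ncard : ℝ) ≤ 1 by exact_mod_cast hle
    simp [hG] at hu
  refine ⟨fun u => Set.nonempty_of_ncard_ne_zero (hdeg u).ne_bot, fun u v huv => ?_⟩
  simpa [huv] using hdeg u

/-- The first time without isolated or undecidable points lies between `m₁` and `m₂`, where the
graph is pseudorandom. -/
lemma hittingTimesAgree_of_pseudorandom {σ : RevealOrder V} {m₁ m₂ : ℕ} (hV : 3 ≤ V.card)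
    (hx0 : 0 < x) (hx : 6 * x ≤ V.card) (hearly : ∃ u, (revealedGraph σ m₁).neighborSet u = ∅)
    (hlate : lowDegree (revealedGraph σ m₂) 1 = ∅)
    (hG : Pseudorandom V (revealedGraph σ m₁) (revealedGraph σ m₂) x d) :
    HittingTimesAgree σ := by
  classical
  have hex : ∃ s, NoIsolatedNoUndecidable V (revealedGraph σ s) :=
    ⟨m₂, noIsolatedNoUndecidable_of_lowDegree_eq_empty hlate⟩
  have hle : m₁ ≤ Nat.find hex := by
    by_contra! hlt
    obtain ⟨u, hu⟩ := hearly
    obtain ⟨v, huv⟩ := (Nat.find_spec hex).1 u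
    have huv' : v ∈ (revealedGraph σ m₁).neighborSet u := revealedGraph_mono σ hlt.le huv
    simp [hu] at huv'
  have hge : Nat.find hex ≤ m₂ :=
    Nat.find_min' hex (noIsolatedNoUndecidable_of_lowDegree_eq_empty hlate)
  have hrec : Reconstructible V (revealedGraph σ (Nat.find hex)) :=
    (hG.mono (revealedGraph_mono σ hle) (revealedGraph_mono σ hge)).reconstructible hx0 hx
      (Nat.find_spec hex)
  exact ⟨Nat.find hex, ⟨Nat.find_spec hex, fun s hs => Nat.find_min' hex hs⟩,
    hrec, fun s hs => Nat.find_min' hex (Reconstructible.noIsolatedNoUndecidable hs hV)⟩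

end Reconstruction

section UniformOrders

lemma uniformOn_univ_real {Ω : Type*} [Finite Ω] [MeasurableSpace Ω] [DiscreteMeasurableSpace Ω]
    (A : Set Ω) : (uniformOn (Set.univ : Set Ω)).real A = A.ncard / Nat.card Ω := by
  have := Fintype.ofFinite Ω
  rw [measureReal_def, uniformOn_univ, Measure.count_apply_finite A A.toFinite, ENNReal.toReal_div,
    Set.ncard_eq_toFinset_card A A.toFinite, Nat.card_eq_fintype_card]
  simp

lemma uniformOn_univ_real_preimage {Ω Ω' : Type*} [Finite Ω] [Finite Ω'] [Nonempty Ω]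
    [MeasurableSpace Ω] [DiscreteMeasurableSpace Ω] {g : Ω → Ω'}
    (hg : ∀ y z, (g ⁻¹' {y}).ncard = (g ⁻¹' {z}).ncard) (C : Set Ω') :
    (uniformOn (Set.univ : Set Ω)).real (g ⁻¹' C) = C.ncard / Nat.card Ω' := by
  classical
  have := Fintype.ofFinite Ω
  have := Fintype.ofFinite Ω'
  obtain ⟨σ₀⟩ := ‹Nonempty Ω›
  set k := (g ⁻¹' {g σ₀}).ncard
  have hk : k ≠ 0 := Set.ncard_ne_zero_of_mem (a := σ₀) rfl
  have hcount (D : Set Ω') : (g ⁻¹' D).ncard = D.ncard * k := by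
    rw [Set.ncard_eq_toFinset_card', Set.ncard_eq_toFinset_card',
      card_eq_sum_card_fiberwise (f := g) (t := D.toFinset) fun σ hσ => by simpa using hσ]
    refine sum_const_nat fun y hy => ?_
    rw [show k = (g ⁻¹' {y}).ncard from hg _ _, Set.ncard_eq_toFinset_card']
    congr 1
    ext σ
    simp only [Set.mem_toFinset, mem_filter, Set.mem_preimage, Set.mem_singleton_iff,
      and_iff_right_iff_imp]
    rintro rfl
    exact Set.mem_toFinset.1 hy
  have hΩ : Nat.card Ω = Nat.card Ω' * k := by
    simpa only [Set.preimage_univ, Set.ncard_univ] using hcount Set.univ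
  rw [uniformOn_univ_real, hcount, hΩ]
  push_cast
  exact mul_div_mul_right _ _ (by exact_mod_cast hk)

lemma card_embedding_forall_mem {α ι : Type*} [Finite ι] (S : Finset α) :
    {y : ι ↪ α | ∀ i, y i ∈ S}.ncard = (#S).descFactorial (Nat.card ι) := by
  classical
  have := Fintype.ofFinite ι
  rw [← Fintype.card_coe S, Nat.card_eq_fintype_card, ← Fintype.card_embedding_eq,
    ← Nat.card_eq_fintype_card, ← Nat.card_coe_set_eq]
  exact Nat.card_congr
    { toFun y := ⟨fun i => ⟨y.1 i, y.2 i⟩, fun i j h => y.1.injective (congrArg Subtype.val h)⟩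
      invFun y := ⟨y.trans (.subtype _), fun i => (y i).2⟩
      left_inv _ := rfl
      right_inv _ := rfl }

variable {α β : Type*} [Fintype α] [MeasurableSpace (α ≃ β)] [DiscreteMeasurableSpace (α ≃ β)]
  [Nonempty (α ≃ β)]

lemma uniformOn_univ_real_embedding {ι : Type*} [Finite ι] (j : ι ↪ β) (C : Set (ι ↪ α)) :
    (uniformOn (Set.univ : Set (α ≃ β))).real {σ | j.trans σ.symm.toEmbedding ∈ C} =
      C.ncard / (Fintype.card α).descFactorial (Nat.card ι) := by
  have := Fintype.ofFinite ι
  rw [Nat.card_eq_fintype_card, ← Fintype.card_embedding_eq, ← Nat.card_eq_fintype_card]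
  refine uniformOn_univ_real_preimage (g := fun σ : α ≃ β => j.trans σ.symm.toEmbedding)
    (fun y z => ?_) C
  obtain ⟨π, rfl⟩ := Equiv.Perm.exists_smul_eq_embedding z y
  refine Set.ncard_congr (fun σ _ => π.trans σ) ?_ ?_ ?_
  · intro σ hσ
    rw [Set.mem_preimage, Set.mem_singleton_iff] at hσ ⊢
    ext i
    simpa [Equiv.symm_apply_eq] using DFunLike.congr_fun hσ i
  · intro σ τ _ _ h
    exact Equiv.ext fun a => by simpa using DFunLike.congr_fun h (π.symm a)
  · intro σ hσ
    refine ⟨π.symm.trans σ, ?_, by ext; simp⟩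
    rw [Set.mem_preimage, Set.mem_singleton_iff] at hσ ⊢
    ext i
    simpa using congrArg π (DFunLike.congr_fun hσ i)

lemma uniformOn_forall_mem (W : Finset β) (S : Finset α) :
    (uniformOn (Set.univ : Set (α ≃ β))).real {σ | ∀ e ∈ W, σ.symm e ∈ S} =
      (#S).descFactorial #W / (Fintype.card α).descFactorial #W := by
  have h := uniformOn_univ_real_embedding (α := α) (Function.Embedding.subtype (· ∈ W))
    {y | ∀ i, y i ∈ S}
  rw [card_embedding_forall_mem, Nat.card_eq_finsetCard] at h
  simpa using h

lemma uniformOn_forall_mem_forall_mem_le {F W : Finset β} (hFW : Disjoint F W) (S T : Finset α) :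
    (uniformOn (Set.univ : Set (α ≃ β))).real
        {σ | (∀ e ∈ F, σ.symm e ∈ S) ∧ ∀ e ∈ W, σ.symm e ∈ T} ≤
      (#S).descFactorial #F * (#T).descFactorial #W /
        (Fintype.card α).descFactorial (#F + #W) := by
  let j : F ⊕ W ↪ β := ⟨Sum.elim Subtype.val Subtype.val, Subtype.val_injective.sumElim
    Subtype.val_injective fun a b h => disjoint_left.1 hFW a.2 (h ▸ b.2)⟩
  let C : Set (F ⊕ W ↪ α) := {y | (∀ e, y (.inl e) ∈ S) ∧ ∀ e, y (.inr e) ∈ T}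
  have hC : C.ncard ≤ (#S).descFactorial #F * (#T).descFactorial #W := by
    rw [← Fintype.card_coe F, ← Fintype.card_coe W, ← Nat.card_eq_fintype_card,
      ← Nat.card_eq_fintype_card, ← card_embedding_forall_mem, ← card_embedding_forall_mem,
      ← Set.ncard_prod]
    refine Set.ncard_le_ncard_of_injOn
      (fun y => (Function.Embedding.inl.trans y, Function.Embedding.inr.trans y))
      (fun y hy => hy) fun y _ z _ h => ?_
    rw [Prod.mk.injEq] at h
    ext (e | e)
    · exact DFunLike.congr_fun h.1 e
    · exact DFunLike.congr_fun h.2 e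
  have h := uniformOn_univ_real_embedding (α := α) j C
  rw [Nat.card_sum, Nat.card_eq_finsetCard, Nat.card_eq_finsetCard] at h
  have hset : {σ : α ≃ β | j.trans σ.symm.toEmbedding ∈ C} =
      {σ | (∀ e ∈ F, σ.symm e ∈ S) ∧ ∀ e ∈ W, σ.symm e ∈ T} := by
    ext σ
    simp [C, j]
  rw [← hset, h]
  gcongr
  exact_mod_cast hC

lemma cast_sub_div_cast_sub_le {a b : ℕ} (h : a ≤ b) (i : ℕ) :
    ((a - i : ℕ) : ℝ) / (b - i : ℕ) ≤ a / b := by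
  rcases le_or_gt a i with hai | hia
  · rw [Nat.sub_eq_zero_of_le hai]
    simp only [Nat.cast_zero, zero_div]
    positivity
  have hb : (i : ℝ) < b := by exact_mod_cast hia.trans_le h
  rw [Nat.cast_sub hia.le, Nat.cast_sub (hia.le.trans h), div_le_div_iff₀ (by linarith)
    (by linarith [Nat.cast_nonneg (α := ℝ) i])]
  have hab : (a : ℝ) ≤ b := by exact_mod_cast h
  nlinarith [Nat.cast_nonneg (α := ℝ) i]

lemma descFactorial_div_descFactorial_le {a b : ℕ} (h : a ≤ b) (k : ℕ) :
    (a.descFactorial k / b.descFactorial k : ℝ) ≤ (a / b) ^ k := by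
  rw [Nat.descFactorial_eq_prod_range, Nat.descFactorial_eq_prod_range, Nat.cast_prod,
    Nat.cast_prod, ← prod_div_distrib]
  calc ∏ i ∈ range k, ((a - i : ℕ) / (b - i : ℕ) : ℝ) ≤ ∏ _i ∈ range k, (a / b : ℝ) :=
        prod_le_prod (fun _ _ => by positivity) fun i _ => cast_sub_div_cast_sub_le h i
    _ = (a / b) ^ k := by rw [prod_const, card_range]

lemma uniformOn_forall_mem_le (W : Finset β) (S : Finset α) :
    (uniformOn (Set.univ : Set (α ≃ β))).real {σ | ∀ e ∈ W, σ.symm e ∈ S} ≤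
      (#S / Fintype.card α) ^ #W :=
  (uniformOn_forall_mem W S).trans_le (descFactorial_div_descFactorial_le (card_le_univ S) _)

lemma uniformOn_forall_mem_forall_mem_le_pow {F W : Finset β} (hFW : Disjoint F W)
    (S : Finset α) {T : Finset α} (hT : #T + #F ≤ Fintype.card α) :
    (uniformOn (Set.univ : Set (α ≃ β))).real
        {σ | (∀ e ∈ F, σ.symm e ∈ S) ∧ ∀ e ∈ W, σ.symm e ∈ T} ≤
      (#S / Fintype.card α) ^ #F * (#T / (Fintype.card α - #F)) ^ #W := by
  refine (uniformOn_forall_mem_forall_mem_le hFW S T).trans ?_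
  rw [← Nat.descFactorial_mul_descFactorial (Nat.le_add_right #F #W), Nat.add_sub_cancel_left,
    Nat.cast_mul, mul_comm (((Fintype.card α - #F).descFactorial _ : ℕ) : ℝ), mul_div_mul_comm,
    ← Nat.cast_sub (by omega)]
  gcongr
  · exact descFactorial_div_descFactorial_le (card_le_univ S) _
  · exact descFactorial_div_descFactorial_le (by omega) _

end UniformOrders

section Chernoff

variable {Ω β : Type*} [Finite Ω] [MeasurableSpace Ω] [DiscreteMeasurableSpace Ω]
  [DecidableEq β] {P : Measure Ω} [IsFiniteMeasure P] {E : Ω → Finset β} {D : Finset β} {q K : ℝ}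

lemma mgf_card_inter_le (hE : ∀ W ⊆ D, P.real {ω | W ⊆ E ω} ≤ K * q ^ #W) {θ : ℝ} (hθ : 0 ≤ θ) :
    mgf (fun ω => (#(D ∩ E ω) : ℝ)) P θ ≤ K * ((Real.exp θ - 1) * q + 1) ^ #D := by
  have hc : 0 ≤ Real.exp θ - 1 := by linarith [Real.one_le_exp hθ]
  set c := Real.exp θ - 1 with hcdef
  have hexp (ω : Ω) : Real.exp (θ * #(D ∩ E ω)) =
      ∑ W ∈ D.powerset, c ^ #W * {ω | W ⊆ E ω}.indicator 1 ω := by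
    calc Real.exp (θ * #(D ∩ E ω)) = (c + 1) ^ #(D ∩ E ω) := by
          rw [hcdef, sub_add_cancel, mul_comm, Real.exp_nat_mul]
      _ = ∑ W ∈ (D ∩ E ω).powerset, c ^ #W := by
          simp [← sum_pow_mul_eq_add_pow]
      _ = ∑ W ∈ D.powerset, c ^ #W * {ω | W ⊆ E ω}.indicator 1 ω := by
          have hsub : (D ∩ E ω).powerset = {W ∈ D.powerset | W ⊆ E ω} := by
            ext W
            simp only [mem_powerset, mem_filter, subset_inter_iff]
          simp [hsub, sum_filter, Set.indicator_apply]
  calc mgf (fun ω => (#(D ∩ E ω) : ℝ)) P θ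
      = ∑ W ∈ D.powerset, c ^ #W * P.real {ω | W ⊆ E ω} := by
        simp_rw [mgf, hexp]
        rw [integral_finsetSum _ fun _ _ => .of_finite]
        refine sum_congr rfl fun W _ => ?_
        rw [integral_const_mul, integral_indicator_one .of_discrete]
    _ ≤ ∑ W ∈ D.powerset, c ^ #W * (K * q ^ #W) := by
        gcongr with W hW
        exact hE W (mem_powerset.1 hW)
    _ = K * (c * q + 1) ^ #D := by
        rw [← sum_pow_mul_eq_add_pow, mul_sum]
        exact sum_congr rfl fun W _ => by rw [one_pow, mul_pow]; ring

lemma measureReal_le_card_inter_le_pow (hE : ∀ W ⊆ D, P.real {ω | W ⊆ E ω} ≤ K * q ^ #W) {θ : ℝ}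
    (hθ : 0 ≤ θ) (k : ℝ) :
    P.real {ω | k ≤ #(D ∩ E ω)} ≤
      Real.exp (-θ * k) * (K * ((Real.exp θ - 1) * q + 1) ^ #D) := by
  refine (measure_ge_le_exp_mul_mgf k hθ .of_finite).trans ?_
  gcongr
  exact mgf_card_inter_le hE hθ

lemma measureReal_le_card_inter_le (hE : ∀ W ⊆ D, P.real {ω | W ⊆ E ω} ≤ K * q ^ #W) {θ : ℝ}
    (hθ : 0 ≤ θ) (hq : 0 ≤ q) (k : ℝ) :
    P.real {ω | k ≤ #(D ∩ E ω)} ≤ K * Real.exp ((Real.exp θ - 1) * q * #D - θ * k) := by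
  have hK : 0 ≤ K := by simpa using measureReal_nonneg.trans (hE ∅ (empty_subset D))
  have hc : 0 ≤ Real.exp θ - 1 := by linarith [Real.one_le_exp hθ]
  calc P.real {ω | k ≤ #(D ∩ E ω)}
      ≤ Real.exp (-θ * k) * (K * ((Real.exp θ - 1) * q + 1) ^ #D) :=
        measureReal_le_card_inter_le_pow hE hθ k
    _ ≤ Real.exp (-θ * k) * (K * Real.exp ((Real.exp θ - 1) * q) ^ #D) := by
        gcongr
        exact Real.add_one_le_exp _
    _ = K * Real.exp ((Real.exp θ - 1) * q * #D - θ * k) := by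
        rw [← Real.exp_nat_mul, mul_left_comm, ← Real.exp_add]
        ring_nf

lemma measureReal_card_sdiff_le_le (hE : ∀ W ⊆ D, P.real {ω | W ⊆ E ω} ≤ K * q ^ #W) {θ : ℝ}
    (hθ : 0 ≤ θ) (hq : 0 ≤ q) (k : ℝ) :
    P.real {ω | #(D \ E ω) ≤ k} ≤
      K * Real.exp (θ * k - (1 - Real.exp (-θ)) * (1 - q) * #D) := by
  have hK : 0 ≤ K := by simpa using measureReal_nonneg.trans (hE ∅ (empty_subset D))
  have hset : {ω | #(D \ E ω) ≤ k} = {ω | #D - k ≤ #(D ∩ E ω)} := by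
    ext ω
    have hsum : (#(D \ E ω) : ℝ) + #(D ∩ E ω) = #D := by
      exact_mod_cast card_sdiff_add_card_inter D (E ω)
    simp only [Set.mem_ofPred_eq]
    constructor <;> intro h <;> linarith
  rw [hset]
  calc P.real {ω | #D - k ≤ #(D ∩ E ω)}
      ≤ Real.exp (-θ * (#D - k)) * (K * ((Real.exp θ - 1) * q + 1) ^ #D) :=
        measureReal_le_card_inter_le_pow hE hθ _
    _ = K * (Real.exp (θ * k) * (-((1 - Real.exp (-θ)) * (1 - q)) + 1) ^ #D) := by
        have hbase : -((1 - Real.exp (-θ)) * (1 - q)) + 1 =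
            Real.exp (-θ) * ((Real.exp θ - 1) * q + 1) := by
          have hinv : Real.exp (-θ) * Real.exp θ = 1 := by rw [← Real.exp_add]; simp
          linear_combination -q * hinv
        rw [hbase, mul_pow, ← Real.exp_nat_mul,
          show -θ * (#D - k) = θ * k + #D * -θ by ring, Real.exp_add]
        ring
    _ ≤ K * (Real.exp (θ * k) * Real.exp (-((1 - Real.exp (-θ)) * (1 - q))) ^ #D) := by
        have hbase : 0 ≤ -((1 - Real.exp (-θ)) * (1 - q)) + 1 := by
          have := Real.exp_le_one_iff.2 (neg_nonpos.2 hθ)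
          nlinarith [Real.exp_pos (-θ)]
        gcongr
        exact Real.add_one_le_exp _
    _ = K * Real.exp (θ * k - (1 - Real.exp (-θ)) * (1 - q) * #D) := by
        rw [← Real.exp_nat_mul, ← Real.exp_add]
        ring_nf

end Chernoff

section Pairs

variable {V : Finset ℝ} {σ : RevealOrder V} {m : ℕ}

/-- The pairs of distinct points of `V`, whose distances are revealed. -/
abbrev Pair (V : Finset ℝ) : Type := (⊤ : SimpleGraph V).edgeSet

/-- The pairs that contain the point `u`. -/
noncomputable def pairsAt (u : V) : Finset (Pair V) := {e | u ∈ (e : Sym2 V)}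

/-- The pairs of members of `L`. -/
noncomputable def pairsIn (L : Finset V) : Finset (Pair V) := {e | (e : Sym2 V) ∈ L.sym2}

/-- The pairs of a member of `A` and a member of `B`. -/
noncomputable def pairsBetween (A B : Finset V) : Finset (Pair V) :=
  {e | ∃ u ∈ A, ∃ v ∈ B, (e : Sym2 V) = s(u, v)}

/-- The pairs whose distances are among the first `m` revealed, i.e. the edges of
`revealedGraph σ m`. -/
noncomputable def revealedPairs (σ : RevealOrder V) (m : ℕ) : Finset (Pair V) :=
  {e | (σ.symm e : ℕ) < m}

lemma mem_edgeSet_revealedGraph (e : Pair V) :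
    (e : Sym2 V) ∈ (revealedGraph σ m).edgeSet ↔ e ∈ revealedPairs σ m := by
  have hdiag : ¬ (e : Sym2 V).IsDiag := by simpa using e.2
  simp only [revealedGraph, SimpleGraph.edgeSet_fromEdgeSet, Set.mem_sdiff, Set.mem_ofPred_eq,
    Subtype.coe_inj, revealedPairs, mem_filter_univ]
  constructor
  · rintro ⟨⟨i, hi, rfl⟩, -⟩
    simpa using hi
  · exact fun h => ⟨⟨σ.symm e, h, by simp⟩, hdiag⟩

lemma adj_revealedGraph (u v : V) (h : u ≠ v) :
    (revealedGraph σ m).Adj u v ↔ (⟨s(u, v), h⟩ : Pair V) ∈ revealedPairs σ m := by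
  rw [← mem_edgeSet_revealedGraph, SimpleGraph.mem_edgeSet]

lemma ncard_neighborSet_eq_ncard_pairsAt_inter (G : SimpleGraph V) (u : V) :
    (G.neighborSet u).ncard = (↑(pairsAt u) ∩ {e : Pair V | (e : Sym2 V) ∈ G.edgeSet}).ncard := by
  classical
  rw [← Nat.card_coe_set_eq, ← Nat.card_congr (G.incidenceSetEquivNeighborSet u),
    Nat.card_coe_set_eq, ← Set.ncard_image_of_injective _ Subtype.val_injective]
  congr 1
  ext e
  simp only [SimpleGraph.incidenceSet, Set.mem_image, Set.mem_inter_iff, pairsAt,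
    mem_coe, mem_filter_univ, Set.mem_ofPred_eq]
  constructor
  · rintro ⟨he, hu⟩
    exact ⟨⟨e, SimpleGraph.edgeSet_mono le_top he⟩, ⟨hu, he⟩, rfl⟩
  · rintro ⟨e, ⟨hu, he⟩, rfl⟩
    exact ⟨he, hu⟩

lemma ncard_neighborSet_revealedGraph (u : V) :
    ((revealedGraph σ m).neighborSet u).ncard = #(pairsAt u ∩ revealedPairs σ m) := by
  rw [ncard_neighborSet_eq_ncard_pairsAt_inter, ← Set.ncard_coe_finset, coe_inter]
  congr 2
  ext e
  exact mem_edgeSet_revealedGraph e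

lemma card_pairsAt (u : V) : #(pairsAt u) = #V - 1 := by
  have h := ncard_neighborSet_eq_ncard_pairsAt_inter ⊤ u
  rw [Set.inter_eq_left.2 fun e _ => e.2, Set.ncard_coe_finset] at h
  rw [← h, SimpleGraph.neighborSet_top, Set.ncard_compl, Set.ncard_singleton,
    Nat.card_eq_finsetCard]

lemma card_pairsAt_inter_pairsAt {u w : V} (h : u ≠ w) : #(pairsAt u ∩ pairsAt w) = 1 := by
  refine card_eq_one.2 ⟨⟨s(u, w), h⟩, ?_⟩
  ext e
  simp only [pairsAt, mem_inter, mem_filter_univ, Sym2.mem_and_mem_iff h, mem_singleton,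
    Subtype.ext_iff]

lemma card_pairsAt_union_pairsAt {u w : V} (h : u ≠ w) : #(pairsAt u ∪ pairsAt w) = 2 * #V - 3 := by
  rw [card_union, card_pairsAt, card_pairsAt, card_pairsAt_inter_pairsAt h]
  omega

lemma card_pairsIn_le (L : Finset V) : #(pairsIn L) ≤ #L ^ 2 := by
  have hle : #(pairsIn L) ≤ #L.sym2 :=
    card_le_card_of_injOn Subtype.val
      (fun e he => by simpa only [pairsIn, mem_coe, mem_filter_univ] using he)
      Subtype.val_injective.injOn
  rw [card_sym2, Nat.choose_two_right, Nat.add_sub_cancel] at hle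
  refine hle.trans (Nat.div_le_of_le_mul ?_)
  nlinarith [Nat.zero_le (#L), Nat.le_self_pow two_ne_zero (#L)]

lemma card_mul_card_le_card_pairsBetween {A B : Finset V} (h : Disjoint A B) :
    #A * #B ≤ #(pairsBetween A B) := by
  have hne {u v : V} (hu : u ∈ A) (hv : v ∈ B) : u ≠ v := fun he => disjoint_left.1 h hu (he ▸ hv)
  rw [← card_product, ← card_map (.subtype _)]
  refine card_le_card_of_injOn (fun p => s(p.1, p.2)) ?_ ?_
  · rintro ⟨u, v⟩ huv
    obtain ⟨hu, hv⟩ := mem_product.1 huv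
    simpa [pairsBetween] using ⟨⟨u, u.2, hu, v, v.2, hv, .inl ⟨rfl, rfl⟩⟩, hne hu hv⟩
  · rintro ⟨u, v⟩ huv ⟨u', v'⟩ huv' heq
    rcases Sym2.eq_iff.1 heq with ⟨rfl, rfl⟩ | ⟨rfl, rfl⟩
    · rfl
    · exact absurd rfl (hne (mem_product.1 huv).1 (mem_product.1 huv').2)

/-- Every pair within `L` is counted at its two ends. -/
lemma sum_ncard_neighborSet_inter_le (L : Finset V) :
    ∑ u ∈ L, ((revealedGraph σ m).neighborSet u ∩ L).ncard ≤
      2 * #(pairsIn L ∩ revealedPairs σ m) := by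
  classical
  have hle (u : V) (hu : u ∈ L) : ((revealedGraph σ m).neighborSet u ∩ L).ncard ≤
      #{e ∈ pairsIn L ∩ revealedPairs σ m | u ∈ e.1} := by
    rw [← card_map (.subtype _), ← Set.ncard_coe_finset]
    refine Set.ncard_le_ncard_of_injOn (fun v => s(u, v)) ?_
      fun v _ w _ heq => Sym2.congr_right.1 heq
    rintro v ⟨huv : (revealedGraph σ m).Adj u v, hv⟩
    have hrev := (adj_revealedGraph u v huv.ne).1 huv
    rw [mem_coe, mem_map]
    refine ⟨⟨s(u, v), huv.ne⟩, ?_, rfl⟩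
    have hin : (⟨s(u, v), huv.ne⟩ : Pair V) ∈ pairsIn L :=
      (mem_filter_univ _).2 (mk_mem_sym2_iff.2 ⟨hu, hv⟩)
    exact mem_filter.2 ⟨mem_inter.2 ⟨hin, hrev⟩, Sym2.mem_mk_left u v⟩
  calc ∑ u ∈ L, ((revealedGraph σ m).neighborSet u ∩ L).ncard
      ≤ ∑ u ∈ L, #{e ∈ pairsIn L ∩ revealedPairs σ m | u ∈ e.1} := sum_le_sum hle
    _ = ∑ e ∈ pairsIn L ∩ revealedPairs σ m, #{u ∈ L | u ∈ e.1} :=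
        sum_card_bipartiteAbove_eq_sum_card_bipartiteBelow fun u (e : Pair V) => u ∈ e.1
    _ ≤ ∑ _e ∈ pairsIn L ∩ revealedPairs σ m, 2 := by
        gcongr with e
        rw [← Sym2.card_toFinset_of_not_isDiag (e : Sym2 V) (by simpa using e.2)]
        exact card_le_card fun u hu => Sym2.mem_toFinset.2 (mem_filter.1 hu).2
    _ = 2 * #(pairsIn L ∩ revealedPairs σ m) := by rw [sum_const, smul_eq_mul, mul_comm]

end Pairs

section UniformRevealOrder

instance (V : Finset ℝ) : DiscreteMeasurableSpace (RevealOrder V) := ⟨fun _ => trivial⟩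

variable {V : Finset ℝ}

lemma card_pair : Fintype.card (Pair V) = (#V).choose 2 := by
  rw [SimpleGraph.card_edgeSet, SimpleGraph.card_edgeFinset_top_eq_card_choose_two,
    Fintype.card_coe]

instance : Nonempty (RevealOrder V) := (Fintype.card_eq.1 (by rw [Fintype.card_fin, card_pair]))

/-- The uniform distribution on the orders of revelation. -/
noncomputable abbrev uniformOrder (V : Finset ℝ) : Measure (RevealOrder V) := uniformOn Set.univ

variable {m m₁ m₂ : ℕ}

lemma measureReal_subset_revealedPairs_le (W : Finset (Pair V)) :
    (uniformOrder V).real {σ | W ⊆ revealedPairs σ m} ≤ (m / (#V).choose 2) ^ #W := by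
  calc (uniformOrder V).real {σ | W ⊆ revealedPairs σ m}
      = (uniformOrder V).real
          {σ | ∀ e ∈ W, σ.symm e ∈ ({i | (i : ℕ) < m} : Finset (Fin ((#V).choose 2)))} := by
        simp only [revealedPairs, subset_iff, mem_filter_univ]
    _ ≤ _ := uniformOn_forall_mem_le W _
    _ ≤ (m / (#V).choose 2) ^ #W := by
        rw [Fin.card_filter_val_lt, Fintype.card_fin]
        gcongr
        exact min_le_right _ _

lemma disjoint_revealedPairs_iff {σ : RevealOrder V} (W : Finset (Pair V)) :
    Disjoint W (revealedPairs σ m) ↔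
      ∀ e ∈ W, σ.symm e ∈ ({i | (i : ℕ) < m} : Finset (Fin ((#V).choose 2)))ᶜ := by
  simp only [disjoint_left, revealedPairs, mem_compl, mem_filter_univ]

lemma card_compl_filter_val_lt (n m : ℕ) : #({i : Fin n | (i : ℕ) < m} : Finset _)ᶜ = n - m := by
  rw [card_compl, Fin.card_filter_val_lt, Fintype.card_fin]
  omega

lemma measureReal_disjoint_revealedPairs (W : Finset (Pair V)) :
    (uniformOrder V).real {σ | Disjoint W (revealedPairs σ m)} =
      (((#V).choose 2 - m).descFactorial #W / ((#V).choose 2).descFactorial #W : ℝ) := by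
  simp only [disjoint_revealedPairs_iff]
  rw [uniformOn_forall_mem, card_compl_filter_val_lt, Fintype.card_fin]

lemma measureReal_subset_revealedPairs_and_disjoint_le {F W : Finset (Pair V)} (hFW : Disjoint F W)
    (hF : #F ≤ m₁) (hm₁ : m₁ ≤ (#V).choose 2) :
    (uniformOrder V).real {σ | F ⊆ revealedPairs σ m₂ ∧ Disjoint W (revealedPairs σ m₁)} ≤
      (m₂ / (#V).choose 2) ^ #F * (((#V).choose 2 - m₁) / ((#V).choose 2 - #F)) ^ #W := by
  have hF' : 0 ≤ ((#V).choose 2 - #F : ℝ) := sub_nonneg.2 (by exact_mod_cast hF.trans hm₁)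
  have hm₁' : 0 ≤ ((#V).choose 2 - m₁ : ℝ) := sub_nonneg.2 (by exact_mod_cast hm₁)
  have hearly {σ : RevealOrder V} : F ⊆ revealedPairs σ m₂ ↔
      ∀ e ∈ F, σ.symm e ∈ ({i | (i : ℕ) < m₂} : Finset (Fin ((#V).choose 2))) := by
    simp only [revealedPairs, subset_iff, mem_filter_univ]
  simp only [disjoint_revealedPairs_iff, hearly]
  refine (uniformOn_forall_mem_forall_mem_le_pow hFW _ ?_).trans ?_
  · rw [card_compl_filter_val_lt, Fintype.card_fin]
    omega
  · rw [card_compl_filter_val_lt, Fin.card_filter_val_lt, Fintype.card_fin, Nat.cast_sub hm₁]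
    gcongr
    exact min_le_right _ _

end UniformRevealOrder

section RareEvents

lemma measureReal_exists_le_card_mul {Ω ι : Type*} [MeasurableSpace Ω] {P : Measure Ω}
    [IsFiniteMeasure P] {I : Finset ι} {A : ι → Set Ω} {c : ℝ} (h : ∀ i ∈ I, P.real (A i) ≤ c) :
    P.real {ω | ∃ i ∈ I, ω ∈ A i} ≤ #I * c := by
  have hset : {ω | ∃ i ∈ I, ω ∈ A i} = ⋃ i ∈ I, A i := by ext; simp
  rw [hset, ← nsmul_eq_mul]
  exact (measureReal_biUnion_finset_le I A).trans (sum_le_card_nsmul I _ c h)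

variable {V : Finset ℝ} {m m₁ m₂ : ℕ}

/-- The proportion of the distances between `n` points that is revealed at time `m`. -/
noncomputable def density (n m : ℕ) : ℝ := m / n.choose 2

lemma density_nonneg (n m : ℕ) : 0 ≤ density n m := by
  unfold density
  positivity

lemma measureReal_subset_and_card_inter_le {F D : Finset (Pair V)} (hFD : Disjoint F D)
    (hF : #F ≤ m₁) (hm₁ : m₁ ≤ (#V).choose 2) {θ : ℝ} (hθ : 0 ≤ θ) (k : ℝ) :
    (uniformOrder V).real {σ | F ⊆ revealedPairs σ m₂ ∧ #(D ∩ revealedPairs σ m₁) ≤ k} ≤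
      density #V m₂ ^ #F *
        Real.exp (θ * k - (1 - Real.exp (-θ)) * ((m₁ - #F) / (#V).choose 2) * #D) := by
  have hm₁' : (m₁ : ℝ) ≤ (#V).choose 2 := by exact_mod_cast hm₁
  have hF' : (#F : ℝ) ≤ m₁ := by exact_mod_cast hF
  set N := ((#V).choose 2 : ℝ)
  set q : ℝ := (N - m₁) / (N - #F)
  set A : Set (RevealOrder V) := {σ | F ⊆ revealedPairs σ m₂}
  have hE (W : Finset (Pair V)) (hW : W ⊆ D) :
      ((uniformOrder V).restrict A).real {σ | W ⊆ (revealedPairs σ m₁)ᶜ} ≤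
        density #V m₂ ^ #F * q ^ #W := by
    rw [measureReal_restrict_apply .of_discrete, Set.inter_comm]
    simp only [subset_compl_iff_disjoint_right]
    exact measureReal_subset_revealedPairs_and_disjoint_le (hFD.mono_right hW) hF hm₁
  have hq : (m₁ - #F) / N ≤ 1 - q := by
    rcases (hF'.trans hm₁').eq_or_lt with hN | hN
    · simp [q, ← hN, le_antisymm (hN ▸ hm₁') hF']
    · have hN' : N - #F ≠ 0 := by linarith
      rw [one_sub_div hN', sub_sub_sub_cancel_left]
      exact div_le_div_of_nonneg_left (by linarith) (by linarith) (by simp)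
  have h := measureReal_card_sdiff_le_le hE hθ (div_nonneg (by linarith) (by linarith)) k
  simp only [sdiff_compl, inf_eq_inter] at h
  rw [measureReal_restrict_apply .of_discrete, Set.inter_comm] at h
  refine h.trans ?_
  have := Real.exp_le_one_iff.2 (neg_nonpos.2 hθ)
  have := density_nonneg #V m₂
  gcongr

lemma measureReal_lowDegree_one_nonempty_le (hm : m ≤ (#V).choose 2) {θ : ℝ} (hθ : 0 ≤ θ) :
    (uniformOrder V).real {σ | (lowDegree (revealedGraph σ m) 1).Nonempty} ≤
      #V * Real.exp (θ - (1 - Real.exp (-θ)) * density #V m * (#V - 1)) := by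
  have hu (u : V) : (uniformOrder V).real {σ | u ∈ lowDegree (revealedGraph σ m) 1} ≤
      Real.exp (θ - (1 - Real.exp (-θ)) * density #V m * (#V - 1)) := by
    have h := measureReal_subset_and_card_inter_le (m₂ := m) (disjoint_empty_left (pairsAt u))
      (Nat.zero_le m) hm hθ 1
    have hV : 1 ≤ #V := card_pos.2 ⟨u, u.2⟩
    simpa [card_pairsAt, Nat.cast_sub hV, lowDegree, ncard_neighborSet_revealedGraph, density]
      using h
  have h := measureReal_exists_le_card_mul (I := univ) fun u _ => hu u
  simpa [Set.Nonempty] using h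

/-- The bound on the probability that two given vertices out of `n` have degree at most `k` at time
`m₁`, where up to two of the pairs at these vertices are left out of the count. -/
noncomputable def lowPairBound (n m₁ : ℕ) (θ k : ℝ) : ℝ :=
  Real.exp (2 * θ * k - (1 - Real.exp (-θ)) * ((m₁ - 2) / n.choose 2) * (2 * n - 5))

lemma measureReal_subset_and_mem_lowDegree_le {u w : V} (huw : u ≠ w) {F : Finset (Pair V)}
    (hF : #F ≤ 2) (hm₁ : 2 ≤ m₁) (hm₁' : m₁ ≤ (#V).choose 2) {θ : ℝ} (hθ : 0 ≤ θ) (k : ℝ) :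
    (uniformOrder V).real {σ | F ⊆ revealedPairs σ m₂ ∧
        u ∈ lowDegree (revealedGraph σ m₁) k ∧ w ∈ lowDegree (revealedGraph σ m₁) k} ≤
      density #V m₂ ^ #F * lowPairBound #V m₁ θ k := by
  set D := (pairsAt u ∪ pairsAt w) \ F
  have hD : 2 * #V ≤ #D + 5 := by
    have hunion := card_pairsAt_union_pairsAt huw
    have hdiff : #(pairsAt u ∪ pairsAt w) - #F ≤ #D := le_card_sdiff F _
    omega
  have hD' : (2 * #V - 5 : ℝ) ≤ #D := by
    have : (2 * #V : ℝ) ≤ #D + 5 := by exact_mod_cast hD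
    linarith
  have hsub : {σ : RevealOrder V | F ⊆ revealedPairs σ m₂ ∧
      u ∈ lowDegree (revealedGraph σ m₁) k ∧ w ∈ lowDegree (revealedGraph σ m₁) k} ⊆
      {σ | F ⊆ revealedPairs σ m₂ ∧ #(D ∩ revealedPairs σ m₁) ≤ 2 * k} := by
    rintro σ ⟨hFσ, hu, hw⟩
    simp only [lowDegree, Set.mem_ofPred_eq, ncard_neighborSet_revealedGraph] at hu hw
    have hcard : #(D ∩ revealedPairs σ m₁) ≤
        #(pairsAt u ∩ revealedPairs σ m₁) + #(pairsAt w ∩ revealedPairs σ m₁) := by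
      refine (card_le_card ?_).trans (card_union_le _ _)
      rw [← union_inter_distrib_right]
      exact inter_subset_inter_right sdiff_subset
    have hcard' : (#(D ∩ revealedPairs σ m₁) : ℝ) ≤
        #(pairsAt u ∩ revealedPairs σ m₁) + #(pairsAt w ∩ revealedPairs σ m₁) := by
      exact_mod_cast hcard
    exact ⟨hFσ, by linarith⟩
  have hm₁2 : (2 : ℝ) ≤ m₁ := by exact_mod_cast hm₁
  have hF2 : (#F : ℝ) ≤ 2 := by exact_mod_cast hF
  calc _ ≤ (uniformOrder V).real
          {σ | F ⊆ revealedPairs σ m₂ ∧ #(D ∩ revealedPairs σ m₁) ≤ 2 * k} := measureReal_mono hsub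
    _ ≤ _ := measureReal_subset_and_card_inter_le disjoint_sdiff (hF.trans hm₁) hm₁' hθ _
    _ ≤ density #V m₂ ^ #F * lowPairBound #V m₁ θ k := by
        have := Real.exp_le_one_iff.2 (neg_nonpos.2 hθ)
        have := density_nonneg #V m₂
        have hexp : (1 - Real.exp (-θ)) * ((m₁ - 2) / (#V).choose 2) * (2 * #V - 5) ≤
            (1 - Real.exp (-θ)) * ((m₁ - #F) / (#V).choose 2) * #D := by
          refine mul_le_mul_of_nonneg ?_ hD' ?_ (by positivity)
          · gcongr
          · exact mul_nonneg (by linarith) (div_nonneg (by linarith) (by positivity))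
        rw [lowPairBound, ← mul_assoc, mul_comm θ 2]
        gcongr

lemma measureReal_le_of_forall_exists_lowDegree {ι : Type*} [Fintype ι] {u w : ι → V}
    {F : ι → Finset (Pair V)} {f c : ℕ} (huw : ∀ i, u i ≠ w i) (hF : ∀ i, #(F i) = f) (hf : f ≤ 2)
    (hι : Fintype.card ι ≤ c) (hm₁ : 2 ≤ m₁) (hm₁' : m₁ ≤ (#V).choose 2) {θ k : ℝ} (hθ : 0 ≤ θ)
    {A : Set (RevealOrder V)} (hA : ∀ σ ∈ A, ∃ i, F i ⊆ revealedPairs σ m₂ ∧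
      u i ∈ lowDegree (revealedGraph σ m₁) k ∧ w i ∈ lowDegree (revealedGraph σ m₁) k) :
    (uniformOrder V).real A ≤ c * (density #V m₂ ^ f * lowPairBound #V m₁ θ k) := by
  have hpair (i : ι) (_ : i ∈ univ) := measureReal_subset_and_mem_lowDegree_le (m₂ := m₂) (huw i)
    ((hF i).trans_le hf) hm₁ hm₁' hθ k
  simp only [hF] at hpair
  have hsub : A ⊆ {σ | ∃ i ∈ univ, σ ∈ {σ | F i ⊆ revealedPairs σ m₂ ∧
      u i ∈ lowDegree (revealedGraph σ m₁) k ∧ w i ∈ lowDegree (revealedGraph σ m₁) k}} :=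
    fun σ hσ => (hA σ hσ).imp fun i hi => ⟨mem_univ i, hi⟩
  refine (measureReal_mono hsub).trans ((measureReal_exists_le_card_mul hpair).trans ?_)
  have := density_nonneg #V m₂
  have : 0 ≤ lowPairBound #V m₁ θ k := (Real.exp_pos _).le
  rw [card_univ]
  gcongr

lemma measureReal_not_isIndepSet_le (hm₁ : 2 ≤ m₁) (hm₁' : m₁ ≤ (#V).choose 2) {θ : ℝ}
    (hθ : 0 ≤ θ) (k : ℝ) :
    (uniformOrder V).real
        {σ | ¬ (revealedGraph σ m₂).IsIndepSet (lowDegree (revealedGraph σ m₁) k)} ≤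
      (#V ^ 2 : ℕ) * (density #V m₂ ^ 1 * lowPairBound #V m₁ θ k) := by
  let ι := {p : V × V // p.1 ≠ p.2}
  have hι : Fintype.card ι ≤ #V ^ 2 :=
    (Fintype.card_subtype_le _).trans_eq (by rw [Fintype.card_prod, Fintype.card_coe, sq])
  refine measureReal_le_of_forall_exists_lowDegree (u := fun i : ι => i.1.1) (w := fun i => i.1.2)
    (F := fun i => {⟨s(i.1.1, i.1.2), i.2⟩}) (fun i => i.2) (fun _ => card_singleton _) one_le_two
    hι hm₁ hm₁' hθ fun σ hσ => ?_
  simp only [Set.mem_ofPred_eq, SimpleGraph.IsIndepSet, Set.Pairwise, not_forall, not_not] at hσ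
  obtain ⟨u, hu, w, hw, huw, hadj⟩ := hσ
  exact ⟨⟨(u, w), huw⟩, singleton_subset_iff.2 ((adj_revealedGraph u w huw).1 hadj), hu, hw⟩

lemma measureReal_not_pairwiseDisjoint_le (hm₁ : 2 ≤ m₁) (hm₁' : m₁ ≤ (#V).choose 2) {θ : ℝ}
    (hθ : 0 ≤ θ) (k : ℝ) :
    (uniformOrder V).real {σ | ¬ (lowDegree (revealedGraph σ m₁) k).PairwiseDisjoint
        (revealedGraph σ m₂).neighborSet} ≤
      (#V ^ 3 : ℕ) * (density #V m₂ ^ 2 * lowPairBound #V m₁ θ k) := by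
  let ι := {p : V × V × V // p.1 ≠ p.2.1 ∧ p.1 ≠ p.2.2 ∧ p.2.1 ≠ p.2.2}
  let F (i : ι) : Finset (Pair V) :=
    {⟨s(i.1.1, i.1.2.2), i.2.2.1⟩, ⟨s(i.1.2.1, i.1.2.2), i.2.2.2⟩}
  have hF (i : ι) : #(F i) = 2 :=
    Finset.card_pair fun h => i.2.1 (Sym2.congr_left.1 (Subtype.ext_iff.1 h))
  have hι : Fintype.card ι ≤ #V ^ 3 := (Fintype.card_subtype_le _).trans_eq
    (by rw [Fintype.card_prod, Fintype.card_prod, Fintype.card_coe, ← sq, ← pow_succ'])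
  refine measureReal_le_of_forall_exists_lowDegree (u := fun i : ι => i.1.1)
    (w := fun i => i.1.2.1) (fun i => i.2.1) hF le_rfl hι hm₁ hm₁' hθ fun σ hσ => ?_
  simp only [Set.mem_ofPred_eq, Set.PairwiseDisjoint, Set.Pairwise, not_forall,
    Set.not_disjoint_iff] at hσ
  obtain ⟨u, hu, w, hw, huw, v, huv, hwv⟩ := hσ
  rw [SimpleGraph.mem_neighborSet] at huv hwv
  refine ⟨⟨(u, w, v), huw, huv.ne, hwv.ne⟩, insert_subset ?_ (singleton_subset_iff.2 ?_), hu, hw⟩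
  · exact (adj_revealedGraph u v huv.ne).1 huv
  · exact (adj_revealedGraph w v hwv.ne).1 hwv

lemma measureReal_not_reflectionFree_le (hm₁ : 2 ≤ m₁) (hm₁' : m₁ ≤ (#V).choose 2) {θ : ℝ}
    (hθ : 0 ≤ θ) (k : ℝ) :
    (uniformOrder V).real
        {σ | ¬ ReflectionFree (revealedGraph σ m₂) (lowDegree (revealedGraph σ m₁) k)} ≤
      (#V ^ 2 : ℕ) * (density #V m₂ ^ 1 * lowPairBound #V m₁ θ k) := by
  let ι := {p : V × V × V // p.1 ≠ p.2.1 ∧ (p.2.2 : ℝ) = 2 * p.2.1 - p.1}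
  have huw (i : ι) : i.1.1 ≠ i.1.2.2 := by
    intro h
    have hw := i.2.2
    rw [← h] at hw
    exact i.2.1 (Subtype.ext (by linarith))
  have hinj : Function.Injective fun i : ι => (i.1.1, i.1.2.1) := by
    rintro ⟨⟨u, v, w⟩, _, hw⟩ ⟨⟨u', v', w'⟩, _, hw'⟩ h
    obtain ⟨rfl, rfl⟩ : u = u' ∧ v = v' := Prod.mk.inj h
    obtain rfl : w = w' := Subtype.ext (hw.trans hw'.symm)
    rfl
  have hι : Fintype.card ι ≤ #V ^ 2 := (Fintype.card_le_of_injective _ hinj).trans_eq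
    (by rw [Fintype.card_prod, Fintype.card_coe, sq])
  refine measureReal_le_of_forall_exists_lowDegree (u := fun i : ι => i.1.1)
    (w := fun i => i.1.2.2) (F := fun i => {⟨s(i.1.1, i.1.2.1), i.2.1⟩}) huw
    (fun _ => card_singleton _) one_le_two hι hm₁ hm₁' hθ fun σ hσ => ?_
  simp only [Set.mem_ofPred_eq, ReflectionFree, not_forall, not_not] at hσ
  obtain ⟨u, hu, w, hw, v, huv, hwv⟩ := hσ
  exact ⟨⟨(u, v, w), huv.ne, hwv⟩,
    singleton_subset_iff.2 ((adj_revealedGraph u v huv.ne).1 huv), hu, hw⟩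

lemma measureReal_disjoint_revealedPairs_le (hm : m ≤ (#V).choose 2) (W : Finset (Pair V)) :
    (uniformOrder V).real {σ | Disjoint W (revealedPairs σ m)} ≤
      Real.exp (-density #V m * #W) := by
  have h := measureReal_subset_revealedPairs_and_disjoint_le (m₂ := 0) (disjoint_empty_left W)
    (Nat.zero_le m) hm
  simp only [empty_subset, true_and, card_empty, pow_zero, one_mul, Nat.cast_zero, sub_zero] at h
  have hm' : 0 ≤ ((#V).choose 2 - m : ℝ) := sub_nonneg.2 (by exact_mod_cast hm)
  rw [mul_comm, Real.exp_nat_mul]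
  refine h.trans (pow_le_pow_left₀ (by positivity) ?_ _)
  calc (((#V).choose 2 - m) / (#V).choose 2 : ℝ) ≤ -density #V m + 1 := by
        rw [sub_div, density, neg_add_eq_sub]
        gcongr
        exact div_self_le_one _
    _ ≤ Real.exp (-density #V m) := Real.add_one_le_exp _

lemma measureReal_not_largeSetsJoined_le (hm : m ≤ (#V).choose 2) {x : ℝ} (hx : 0 ≤ x) :
    (uniformOrder V).real {σ | ¬ LargeSetsJoined (revealedGraph σ m) x} ≤
      4 ^ #V * Real.exp (-density #V m * x ^ 2) := by
  let I : Finset (Finset V × Finset V) := {p | Disjoint p.1 p.2 ∧ x ≤ #p.1 ∧ x ≤ #p.2}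
  have hI : #I ≤ (2 * 2) ^ #V := by
    refine (card_le_univ I).trans_eq ?_
    rw [Fintype.card_prod, Fintype.card_finset, Fintype.card_coe, ← mul_pow]
  have hpair (p : Finset V × Finset V) (hp : p ∈ I) :
      (uniformOrder V).real {σ | Disjoint (pairsBetween p.1 p.2) (revealedPairs σ m)} ≤
        Real.exp (-density #V m * x ^ 2) := by
    obtain ⟨hdisj, hA, hB⟩ := (mem_filter_univ p).1 hp
    have hcard : x ^ 2 ≤ #(pairsBetween p.1 p.2) := by
      calc x ^ 2 ≤ #p.1 * #p.2 := by rw [sq]; gcongr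
        _ ≤ #(pairsBetween p.1 p.2) := by
            exact_mod_cast card_mul_card_le_card_pairsBetween hdisj
    refine (measureReal_disjoint_revealedPairs_le hm _).trans (Real.exp_le_exp.2 ?_)
    exact mul_le_mul_of_nonpos_left hcard (neg_nonpos.2 (density_nonneg #V m))
  have hsub : {σ | ¬ LargeSetsJoined (revealedGraph σ m) x} ⊆
      {σ | ∃ p ∈ I, σ ∈ {σ | Disjoint (pairsBetween p.1 p.2) (revealedPairs σ m)}} := by
    intro σ hσ
    simp only [LargeSetsJoined, not_forall, not_exists, not_and, Set.mem_ofPred_eq] at hσ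
    obtain ⟨A, B, hdisj, hA, hB, hadj⟩ := hσ
    refine ⟨(A, B), (mem_filter_univ _).2 ⟨hdisj, hA, hB⟩, disjoint_left.2 fun e he he' => ?_⟩
    obtain ⟨u, hu, v, hv, huv⟩ := (mem_filter_univ _).1 he
    refine hadj u hu v hv ?_
    rw [← SimpleGraph.mem_edgeSet, ← huv]
    exact (mem_edgeSet_revealedGraph e).2 he'
  refine (measureReal_mono hsub).trans ((measureReal_exists_le_card_mul hpair).trans ?_)
  rw [show (4 : ℝ) = 2 * 2 by norm_num]
  gcongr
  exact_mod_cast hI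

lemma measureReal_forall_lt_ncard_neighborSet_inter_le {L : Finset V} {y : ℝ} (hL : #L ≤ y)
    (d : ℝ) {θ : ℝ} (hθ : 0 ≤ θ) :
    (uniformOrder V).real {σ | ∀ u ∈ L, d < ((revealedGraph σ m).neighborSet u ∩ L).ncard} ≤
      Real.exp ((Real.exp θ - 1) * density #V m * y - θ * d / 2) ^ #L := by
  have hsub : {σ : RevealOrder V | ∀ u ∈ L, d < ((revealedGraph σ m).neighborSet u ∩ L).ncard} ⊆
      {σ | #L * d / 2 ≤ #(pairsIn L ∩ revealedPairs σ m)} := by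
    intro σ hσ
    have hsum := card_nsmul_le_sum L
      (fun u => (((revealedGraph σ m).neighborSet u ∩ L).ncard : ℝ)) d fun u hu => (hσ u hu).le
    have hsum' : (∑ u ∈ L, ((revealedGraph σ m).neighborSet u ∩ L).ncard : ℝ) ≤
        2 * #(pairsIn L ∩ revealedPairs σ m) := by exact_mod_cast sum_ncard_neighborSet_inter_le L
    rw [nsmul_eq_mul] at hsum
    rw [Set.mem_ofPred_eq]
    linarith
  have hE (W : Finset (Pair V)) (_ : W ⊆ pairsIn L) :
      (uniformOrder V).real {σ | W ⊆ revealedPairs σ m} ≤ 1 * density #V m ^ #W := by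
    rw [one_mul]
    exact measureReal_subset_revealedPairs_le W
  have hcard : (#(pairsIn L) : ℝ) ≤ #L * y := by
    calc (#(pairsIn L) : ℝ) ≤ #L ^ 2 := by exact_mod_cast card_pairsIn_le L
      _ ≤ #L * y := by rw [sq]; gcongr
  have hc : 0 ≤ (Real.exp θ - 1) * density #V m :=
    mul_nonneg (by linarith [Real.one_le_exp hθ]) (density_nonneg #V m)
  calc _ ≤ (uniformOrder V).real {σ | #L * d / 2 ≤ #(pairsIn L ∩ revealedPairs σ m)} :=
        measureReal_mono hsub
    _ ≤ 1 * Real.exp ((Real.exp θ - 1) * density #V m * #(pairsIn L) - θ * (#L * d / 2)) :=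
        measureReal_le_card_inter_le hE hθ (density_nonneg #V m) _
    _ ≤ Real.exp (#L * ((Real.exp θ - 1) * density #V m * y - θ * d / 2)) := by
        rw [one_mul, Real.exp_le_exp]
        nlinarith [mul_le_mul_of_nonneg_left hcard hc]
    _ = _ := Real.exp_nat_mul _ _

lemma measureReal_not_smallSetsSparse_le (y d : ℝ) {θ : ℝ} (hθ : 0 ≤ θ) :
    (uniformOrder V).real {σ | ¬ SmallSetsSparse (revealedGraph σ m) y d} ≤
      Real.exp (#V * Real.exp ((Real.exp θ - 1) * density #V m * y - θ * d / 2)) - 1 := by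
  set z := Real.exp ((Real.exp θ - 1) * density #V m * y - θ * d / 2)
  let I : Finset (Finset V) := {L | L.Nonempty ∧ #L ≤ y}
  have hsub : {σ | ¬ SmallSetsSparse (revealedGraph σ m) y d} ⊆
      ⋃ L ∈ I, {σ | ∀ u ∈ L, d < ((revealedGraph σ m).neighborSet u ∩ L).ncard} := by
    intro σ hσ
    simp only [SmallSetsSparse, not_forall, not_exists, not_and, not_le, Set.mem_ofPred_eq] at hσ
    obtain ⟨L, hne, hL, hd⟩ := hσ
    exact Set.mem_biUnion ((mem_filter_univ L).2 ⟨hne, hL⟩) hd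
  calc _ ≤ ∑ L ∈ I, (uniformOrder V).real
          {σ | ∀ u ∈ L, d < ((revealedGraph σ m).neighborSet u ∩ L).ncard} :=
        (measureReal_mono hsub (measure_ne_top _ _)).trans (measureReal_biUnion_finset_le I _)
    _ ≤ ∑ L ∈ I, z ^ #L := by
        gcongr with L hL
        exact measureReal_forall_lt_ncard_neighborSet_inter_le ((mem_filter_univ L).1 hL).2 d hθ
    _ ≤ ∑ L ∈ (univ : Finset V).powerset.erase ∅, z ^ #L := by
        refine sum_le_sum_of_subset_of_nonneg (fun L hL => ?_) fun L _ _ => by positivity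
        exact mem_erase.2 ⟨((mem_filter_univ L).1 hL).1.ne_empty, mem_powerset.2 (subset_univ L)⟩
    _ = (z + 1) ^ #V - 1 := by
        rw [sum_erase_eq_sub (empty_mem_powerset _), card_empty, pow_zero]
        simpa using sum_pow_mul_eq_add_pow z 1 (univ : Finset V)
    _ ≤ Real.exp (#V * z) - 1 := by
        rw [Real.exp_nat_mul]
        gcongr
        exact Real.add_one_le_exp z

end RareEvents

section IsolatedVertices

variable {Ω ι : Type*} [Finite Ω] [MeasurableSpace Ω] [DiscreteMeasurableSpace Ω] {P : Measure Ω}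
  [Fintype ι] {A : ι → Set Ω}

lemma integral_sum_indicator [IsFiniteMeasure P] :
    P[fun ω => ∑ i, (A i).indicator (1 : Ω → ℝ) ω] = ∑ i, P.real (A i) := by
  rw [integral_finsetSum _ fun _ _ => .of_finite]
  simp_rw [integral_indicator_one (DiscreteMeasurableSpace.forall_measurableSet _)]

lemma integral_sum_indicator_sq [IsFiniteMeasure P] :
    P[(fun ω => ∑ i, (A i).indicator (1 : Ω → ℝ) ω) ^ 2] = ∑ i, ∑ j, P.real (A i ∩ A j) := by
  rw [← Fintype.sum_prod_type' (fun i j => P.real (A i ∩ A j)),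
    ← integral_sum_indicator (A := fun p : ι × ι => A p.1 ∩ A p.2)]
  congr 1
  ext ω
  simp_rw [Pi.pow_apply, sq, sum_mul_sum, Fintype.sum_prod_type, Set.inter_indicator_one,
    Pi.mul_apply]

lemma measureReal_forall_notMem_le [IsProbabilityMeasure P] [Nonempty ι] {q s : ℝ} (hq : 0 < q)
    (hs : 0 ≤ s) (hA : ∀ i, P.real (A i) = q)
    (hAA : ∀ i j, i ≠ j → P.real (A i ∩ A j) ≤ (1 + s) * q ^ 2) :
    P.real {ω | ∀ i, ω ∉ A i} ≤ 1 / (Fintype.card ι * q) + s := by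
  classical
  set n : ℝ := (Fintype.card ι : ℝ)
  have hn : 0 < n := Nat.cast_pos.2 Fintype.card_pos
  let X (ω : Ω) : ℝ := ∑ i, (A i).indicator 1 ω
  have hmean : P[X] = n * q := by
    rw [integral_sum_indicator, sum_congr rfl fun i _ => hA i, sum_const, card_univ, nsmul_eq_mul]
  have hterm (i j : ι) : P.real (A i ∩ A j) ≤ (if i = j then q else 0) + (1 + s) * q ^ 2 := by
    split_ifs with h
    · rw [h, Set.inter_self, hA]
      exact le_add_of_nonneg_right (by positivity)
    · rw [zero_add]
      exact hAA i j h
  have hvar : Var[X; P] ≤ n * q + n ^ 2 * s * q ^ 2 := by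
    calc Var[X; P] = ∑ i, ∑ j, P.real (A i ∩ A j) - (n * q) ^ 2 := by
          rw [variance_eq_sub .of_discrete, integral_sum_indicator_sq, hmean]
      _ ≤ ∑ i : ι, ∑ j : ι, ((if i = j then q else 0) + (1 + s) * q ^ 2) - (n * q) ^ 2 := by
          gcongr with i _ j
          exact hterm i j
      _ = n * q + n ^ 2 * s * q ^ 2 := by
          simp [sum_add_distrib, n]
          ring
  have hsub : {ω | ∀ i, ω ∉ A i} ⊆ {ω | n * q ≤ |X ω - P[X]|} := by
    intro ω hω
    have hX : X ω = 0 := sum_eq_zero fun i _ => Set.indicator_of_notMem (hω i) _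
    rw [Set.mem_ofPred_eq, hX, zero_sub, abs_neg, hmean]
    exact le_abs_self _
  calc P.real {ω | ∀ i, ω ∉ A i} ≤ P.real {ω | n * q ≤ |X ω - P[X]|} := measureReal_mono hsub
    _ ≤ Var[X; P] / (n * q) ^ 2 := ENNReal.toReal_le_of_le_ofReal
        (div_nonneg (variance_nonneg X P) (sq_nonneg _))
        (meas_ge_le_variance_div_sq .of_discrete (by positivity))
    _ ≤ (n * q + n ^ 2 * s * q ^ 2) / (n * q) ^ 2 := by gcongr
    _ = 1 / (n * q) + s := by field_simp

section DescFactorial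

variable {a b j : ℕ}

lemma cast_sub_div_cast_sub_eq (hab : a ≤ b) (hj : j < a) :
    ((a - j : ℕ) / (b - j : ℕ) : ℝ) = (1 + ((b - a : ℕ) / (a - j : ℕ) : ℝ))⁻¹ := by
  have : 0 < ((a - j : ℕ) : ℝ) := by exact_mod_cast Nat.sub_pos_of_lt hj
  rw [one_add_div this.ne', inv_div, ← Nat.cast_add]
  congr 3
  omega

lemma exp_neg_le_descFactorial_div (hab : a ≤ b) (hj : j < a) :
    Real.exp (-((b - a : ℕ) / (a - j : ℕ) : ℝ)) ^ (j + 1) ≤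
      (a.descFactorial (j + 1) / b.descFactorial (j + 1) : ℝ) := by
  rw [Nat.descFactorial_eq_prod_range, Nat.descFactorial_eq_prod_range, Nat.cast_prod,
    Nat.cast_prod, ← prod_div_distrib, ← card_range (j + 1), ← prod_const, card_range]
  refine prod_le_prod (fun _ _ => (Real.exp_pos _).le) fun i hi => ?_
  have hij : i ≤ j := Nat.lt_succ_iff.1 (mem_range.1 hi)
  calc Real.exp (-((b - a : ℕ) / (a - j : ℕ) : ℝ))
      ≤ (1 + ((b - a : ℕ) / (a - j : ℕ) : ℝ))⁻¹ := by
        rw [Real.exp_neg, add_comm]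
        gcongr
        exact Real.add_one_le_exp _
    _ = ((a - j : ℕ) / (b - j : ℕ) : ℝ) := (cast_sub_div_cast_sub_eq hab hj).symm
    _ ≤ ((a - i : ℕ) / (b - i : ℕ) : ℝ) := by
        have h := cast_sub_div_cast_sub_le (Nat.sub_le_sub_right hab i) (j - i)
        rwa [Nat.sub_sub, Nat.sub_sub, Nat.add_sub_cancel' hij] at h

lemma descFactorial_sub_div_le (hab : a ≤ b) (i k : ℕ) :
    ((a - i).descFactorial k / (b - i).descFactorial k : ℝ) ≤
      a.descFactorial k / b.descFactorial k := by
  simp only [Nat.descFactorial_eq_prod_range, Nat.cast_prod, ← prod_div_distrib]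
  refine prod_le_prod (fun _ _ => by positivity) fun l _ => ?_
  rw [Nat.sub_right_comm, Nat.sub_right_comm b]
  exact cast_sub_div_cast_sub_le (Nat.sub_le_sub_right hab l) i

lemma descFactorial_div_le_mul_sq (hab : a ≤ b) (hj : j < a) :
    (a.descFactorial (2 * j + 1) / b.descFactorial (2 * j + 1) : ℝ) ≤
      (1 + ((b - a : ℕ) / (a - j : ℕ) : ℝ)) *
        (a.descFactorial (j + 1) / b.descFactorial (j + 1)) ^ 2 := by
  have hsplit (c : ℕ) :
      c.descFactorial (2 * j + 1) = (c - (j + 1)).descFactorial j * c.descFactorial (j + 1) := by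
    rw [← Nat.descFactorial_mul_descFactorial (show j + 1 ≤ 2 * j + 1 by omega)]
    congr 2
    omega
  set s : ℝ := (b - a : ℕ) / (a - j : ℕ)
  have hfirst : (a.descFactorial j / b.descFactorial j : ℝ) =
      (1 + s) * (a.descFactorial (j + 1) / b.descFactorial (j + 1)) := by
    have hs : 1 + s ≠ 0 := by positivity
    rw [Nat.descFactorial_succ, Nat.descFactorial_succ, Nat.cast_mul, Nat.cast_mul,
      mul_div_mul_comm, cast_sub_div_cast_sub_eq hab hj, mul_inv_cancel_left₀ hs]
  rw [hsplit, hsplit, Nat.cast_mul, Nat.cast_mul, mul_div_mul_comm, sq, ← mul_assoc, ← hfirst]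
  exact mul_le_mul_of_nonneg_right (descFactorial_sub_div_le hab _ _) (by positivity)

end DescFactorial

variable {V : Finset ℝ} {m : ℕ}

lemma disjoint_pairsAt_revealedPairs_iff {σ : RevealOrder V} (u : V) :
    Disjoint (pairsAt u) (revealedPairs σ m) ↔ (revealedGraph σ m).neighborSet u = ∅ := by
  rw [disjoint_iff_inter_eq_empty, ← card_eq_zero, ← ncard_neighborSet_revealedGraph,
    Set.ncard_eq_zero]

lemma measureReal_not_exists_neighborSet_eq_empty_le (hV : 2 ≤ #V) (hm : m + #V ≤ (#V).choose 2) :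
    (uniformOrder V).real {σ | ¬ ∃ u, (revealedGraph σ m).neighborSet u = ∅} ≤
      Real.exp (m / ((#V).choose 2 - m - #V + 2) * #V) / #V +
        m / ((#V).choose 2 - m - #V + 2) := by
  set N := (#V).choose 2
  have : Nonempty V := Fintype.card_pos_iff.1 (by rw [Fintype.card_coe]; omega)
  let A (u : V) : Set (RevealOrder V) := {σ | Disjoint (pairsAt u) (revealedPairs σ m)}
  set s : ℝ := m / (N - m - #V + 2)
  have hs : ((N - (N - m) : ℕ) / (N - m - (#V - 2) : ℕ) : ℝ) = s := by
    rw [Nat.sub_sub_self (by omega), Nat.cast_sub (by omega), Nat.cast_sub (by omega),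
      Nat.cast_sub hV, Nat.cast_two, sub_sub_eq_add_sub, ← sub_add_eq_add_sub]
  have hV1 : #V - 1 = #V - 2 + 1 := by omega
  set q : ℝ := (N - m).descFactorial (#V - 2 + 1) / N.descFactorial (#V - 2 + 1)
  have hA (u : V) : (uniformOrder V).real (A u) = q := by
    rw [measureReal_disjoint_revealedPairs, card_pairsAt, hV1]
  have hAA (u w : V) (huw : u ≠ w) : (uniformOrder V).real (A u ∩ A w) ≤ (1 + s) * q ^ 2 := by
    have hset : A u ∩ A w = {σ | Disjoint (pairsAt u ∪ pairsAt w) (revealedPairs σ m)} :=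
      Set.ext fun σ => disjoint_union_left.symm
    rw [hset, measureReal_disjoint_revealedPairs, card_pairsAt_union_pairsAt huw, ← hs,
      show 2 * #V - 3 = 2 * (#V - 2) + 1 by omega]
    exact descFactorial_div_le_mul_sq (Nat.sub_le N m) (by omega)
  have hs0 : 0 ≤ s := hs ▸ by positivity
  have hq : Real.exp (-(s * #V)) ≤ q := by
    calc Real.exp (-(s * #V)) ≤ Real.exp (-s) ^ (#V - 2 + 1) := by
          rw [← Real.exp_nat_mul, Real.exp_le_exp, mul_neg, neg_le_neg_iff, mul_comm, ← hV1]
          gcongr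
          exact Nat.sub_le _ _
      _ ≤ q := hs ▸ exp_neg_le_descFactorial_div (Nat.sub_le N m) (by omega)
  calc (uniformOrder V).real {σ | ¬ ∃ u, (revealedGraph σ m).neighborSet u = ∅}
      = (uniformOrder V).real {σ | ∀ u, σ ∉ A u} := by
        simp only [A, Set.mem_ofPred_eq, disjoint_pairsAt_revealedPairs_iff, not_exists]
    _ ≤ 1 / (Fintype.card V * q) + s :=
        measureReal_forall_notMem_le ((Real.exp_pos _).trans_le hq) hs0 hA hAA
    _ ≤ 1 / (#V * Real.exp (-(s * #V))) + s := by
        rw [Fintype.card_coe]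
        gcongr
    _ = Real.exp (s * #V) / #V + s := by
        rw [Real.exp_neg]
        field_simp

end IsolatedVertices

section Asymptotics

open Filter Topology Real

lemma tendsto_log_natCast_atTop : Tendsto (fun n : ℕ => log n) atTop atTop :=
  tendsto_log_atTop.comp tendsto_natCast_atTop_atTop

lemma tendsto_const_div_log (c : ℝ) : Tendsto (fun n : ℕ => c / log n) atTop (𝓝 0) :=
  tendsto_log_natCast_atTop.const_div_atTop c

lemma tendsto_const_div_natCast (c : ℝ) : Tendsto (fun n : ℕ => c / n) atTop (𝓝 0) :=
  tendsto_natCast_atTop_atTop.const_div_atTop c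

lemma tendsto_log_div_natCast : Tendsto (fun n : ℕ => log n / n) atTop (𝓝 0) :=
  isLittleO_log_id_atTop.tendsto_div_nhds_zero.comp tendsto_natCast_atTop_atTop

lemma eventually_log_natCast_pos : ∀ᶠ n : ℕ in atTop, 0 < log n :=
  tendsto_log_natCast_atTop.eventually_gt_atTop 0

lemma tendsto_sq_div_choose_two :
    Tendsto (fun n : ℕ => (n : ℝ) ^ 2 / n.choose 2) atTop (𝓝 2) := by
  have h : Tendsto (fun n : ℕ => 2 / (1 - 1 / (n : ℝ))) atTop (𝓝 (2 / (1 - 0))) :=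
    tendsto_const_nhds.div ((tendsto_const_div_natCast 1).const_sub 1) (by norm_num)
  rw [sub_zero, div_one] at h
  refine h.congr' ?_
  filter_upwards [eventually_gt_atTop 1] with n hn
  have hn' : (1 : ℝ) < n := by exact_mod_cast hn
  have : (n : ℝ) - 1 ≠ 0 := by linarith
  rw [Nat.cast_choose_two]
  field_simp

lemma tendsto_mul_log_pow_mul_exp {h : ℕ → ℝ} {c : ℝ}
    (hh : Tendsto (fun n : ℕ => h n / log n) atTop (𝓝 c)) (hc : c < -1) (k : ℕ) :
    Tendsto (fun n : ℕ => n * (log n ^ k * exp (h n))) atTop (𝓝 0) := by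
  obtain ⟨b, hcb, hb⟩ := exists_between hc
  have hlim := ((isLittleO_pow_exp_pos_mul_atTop k
    (show 0 < -(1 + b) by linarith)).tendsto_div_nhds_zero).comp tendsto_log_natCast_atTop
  refine squeeze_zero' ?_ ?_ hlim
  · filter_upwards [eventually_log_natCast_pos] with n hn
    positivity
  · filter_upwards [eventually_log_natCast_pos, hh.eventually_le_const hcb,
      eventually_gt_atTop 0] with n hn hle hn0
    calc n * (log n ^ k * exp (h n)) ≤ exp (log n) * (log n ^ k * exp (b * log n)) := by
          rw [exp_log (by exact_mod_cast hn0)]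
          gcongr
          exact (div_le_iff₀ hn).1 hle
      _ = log n ^ k / exp (-(1 + b) * log n) := by
          rw [neg_mul, exp_neg, div_inv_eq_mul, one_add_mul, exp_add, mul_left_comm]

lemma tendsto_mul_exp {h : ℕ → ℝ} {c : ℝ}
    (hh : Tendsto (fun n : ℕ => h n / log n) atTop (𝓝 c)) (hc : c < -1) :
    Tendsto (fun n : ℕ => n * exp (h n)) atTop (𝓝 0) := by
  simpa only [pow_zero, one_mul] using tendsto_mul_log_pow_mul_exp hh hc 0

variable {m m₁ m₂ : ℕ → ℕ} {a a₁ a₂ : ℝ}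

lemma tendsto_density_mul_div_log (hm : Tendsto (fun n : ℕ => m n / (n * log n)) atTop (𝓝 a)) :
    Tendsto (fun n : ℕ => density n (m n) * n / log n) atTop (𝓝 (2 * a)) := by
  rw [mul_comm]
  refine (hm.mul tendsto_sq_div_choose_two).congr' ?_
  filter_upwards [eventually_log_natCast_pos, eventually_gt_atTop 0] with n hn hn0
  rw [density]
  field_simp

lemma tendsto_density (hm : Tendsto (fun n : ℕ => m n / (n * log n)) atTop (𝓝 a)) :
    Tendsto (fun n : ℕ => density n (m n)) atTop (𝓝 0) := by
  have h := (tendsto_density_mul_div_log hm).mul tendsto_log_div_natCast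
  rw [mul_zero] at h
  refine h.congr' ?_
  filter_upwards [eventually_log_natCast_pos, eventually_gt_atTop 0] with n hn hn0
  field_simp

lemma eventually_le_choose_two (hm : Tendsto (fun n : ℕ => m n / (n * log n)) atTop (𝓝 a)) :
    ∀ᶠ n in atTop, m n ≤ n.choose 2 := by
  filter_upwards [(tendsto_density hm).eventually_le_const one_pos, eventually_ge_atTop 2]
    with n hle hn
  have hN : (0 : ℝ) < n.choose 2 := by exact_mod_cast Nat.choose_pos hn
  exact_mod_cast (div_le_one hN).1 hle

lemma eventually_two_le (hm : Tendsto (fun n : ℕ => m n / (n * log n)) atTop (𝓝 a)) (ha : 0 < a) :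
    ∀ᶠ n in atTop, 2 ≤ m n := by
  have h := hm.pos_mul_atTop ha
    (tendsto_natCast_atTop_atTop.atTop_mul_atTop₀ tendsto_log_natCast_atTop)
  filter_upwards [h.eventually_ge_atTop 2, eventually_log_natCast_pos, eventually_gt_atTop 0]
    with n hle hn hn0
  rw [div_mul_cancel₀ _ (by positivity)] at hle
  exact_mod_cast hle

lemma tendsto_add_self_div_mul_log (hm : Tendsto (fun n : ℕ => m n / (n * log n)) atTop (𝓝 a)) :
    Tendsto (fun n : ℕ => (m n + n : ℕ) / (n * log n)) atTop (𝓝 a) := by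
  have h := hm.add (tendsto_const_div_log 1)
  rw [add_zero] at h
  refine h.congr' ?_
  filter_upwards [eventually_log_natCast_pos, eventually_gt_atTop 0] with n hn hn0
  push_cast
  field_simp

lemma tendsto_lowDegree_one_bound {θ : ℝ}
    (hm : Tendsto (fun n : ℕ => m n / (n * log n)) atTop (𝓝 a))
    (ha : 1 < (1 - exp (-θ)) * (2 * a)) :
    Tendsto (fun n : ℕ => n * exp (θ - (1 - exp (-θ)) * density n (m n) * (n - 1))) atTop
      (𝓝 0) := by
  have hlim := (tendsto_const_div_log θ).sub (((tendsto_density_mul_div_log hm).mul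
    ((tendsto_const_div_natCast 1).const_sub 1)).const_mul (1 - exp (-θ)))
  refine tendsto_mul_exp (hlim.congr' ?_) (by linarith)
  filter_upwards [eventually_log_natCast_pos, eventually_gt_atTop 0] with n hn hn0
  field_simp

lemma tendsto_lowPair_bound {θ δ : ℝ}
    (hm₁ : Tendsto (fun n : ℕ => m₁ n / (n * log n)) atTop (𝓝 a₁))
    (hm₂ : Tendsto (fun n : ℕ => m₂ n / (n * log n)) atTop (𝓝 a₂))
    (ha₁ : 1 + 2 * θ * δ < (1 - exp (-θ)) * (4 * a₁)) (f : ℕ) :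
    Tendsto (fun n : ℕ => (n ^ (f + 1) : ℕ) *
      (density n (m₂ n) ^ f * lowPairBound n (m₁ n) θ (δ * log n))) atTop (𝓝 0) := by
  have hdensity : Tendsto (fun n : ℕ => (m₁ n - 2) / n.choose 2 * n / log n) atTop
      (𝓝 (a₁ * 2)) := by
    have h := (hm₁.sub ((tendsto_const_div_log 2).mul (tendsto_const_div_natCast 1))).mul
      tendsto_sq_div_choose_two
    rw [zero_mul, sub_zero] at h
    refine h.congr' ?_
    filter_upwards [eventually_log_natCast_pos, eventually_gt_atTop 0] with n hn hn0
    field_simp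
  have hexponent : Tendsto (fun n : ℕ => (2 * θ * (δ * log n) -
      (1 - exp (-θ)) * ((m₁ n - 2) / n.choose 2) * (2 * n - 5)) / log n) atTop
      (𝓝 (2 * θ * δ - (1 - exp (-θ)) * (a₁ * 2 * 2))) := by
    have h := ((hdensity.mul ((tendsto_const_div_natCast 5).const_sub 2)).const_mul
      (1 - exp (-θ))).const_sub (2 * θ * δ)
    rw [sub_zero] at h
    refine h.congr' ?_
    filter_upwards [eventually_log_natCast_pos, eventually_gt_atTop 0] with n hn hn0
    field_simp
  have h := ((tendsto_density_mul_div_log hm₂).pow f).mul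
    (tendsto_mul_log_pow_mul_exp hexponent (by linarith) f)
  rw [mul_zero] at h
  refine h.congr' ?_
  filter_upwards [eventually_log_natCast_pos] with n hn
  rw [lowPairBound, div_pow, mul_pow, pow_succ]
  push_cast
  field_simp

lemma tendsto_largeSetsJoined_bound {β : ℝ}
    (hm : Tendsto (fun n : ℕ => m n / (n * log n)) atTop (𝓝 a)) (ha : 0 < a) (hβ : 0 < β) :
    Tendsto (fun n : ℕ => 4 ^ n * exp (-density n (m n) * (β * n) ^ 2)) atTop (𝓝 0) := by
  have hatTop : Tendsto (fun n : ℕ => n * (density n (m n) * n / log n * log n * β ^ 2 - log 4))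
      atTop atTop := by
    refine tendsto_natCast_atTop_atTop.atTop_mul_atTop₀ (tendsto_atTop_add_const_right _ _ ?_)
    exact ((tendsto_density_mul_div_log hm).pos_mul_atTop (by positivity)
      tendsto_log_natCast_atTop).atTop_mul_const (by positivity)
  refine (tendsto_exp_neg_atTop_nhds_zero.comp hatTop).congr' ?_
  filter_upwards [eventually_log_natCast_pos] with n hn
  rw [Function.comp_apply, div_mul_cancel₀ _ hn.ne', ← exp_log (show (0 : ℝ) < 4 by norm_num),
    ← exp_nat_mul, ← exp_add, log_exp]
  congr 1
  ring

lemma tendsto_smallSetsSparse_bound {θ β δ : ℝ}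
    (hm : Tendsto (fun n : ℕ => m n / (n * log n)) atTop (𝓝 a))
    (ha : 1 + (exp θ - 1) * (2 * a) * (2 * β) < θ * δ / 2) :
    Tendsto (fun n : ℕ => exp (n * exp ((exp θ - 1) * density n (m n) * (2 * (β * n)) -
      θ * (δ * log n - 2) / 2)) - 1) atTop (𝓝 0) := by
  have hlim := (((tendsto_density_mul_div_log hm).const_mul (exp θ - 1)).mul_const (2 * β)).sub
    ((tendsto_const_div_log 2).const_sub δ |>.const_mul θ |>.div_const 2)
  rw [sub_zero] at hlim
  have h : Tendsto (fun n : ℕ => n * exp ((exp θ - 1) * density n (m n) * (2 * (β * n)) -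
      θ * (δ * log n - 2) / 2)) atTop (𝓝 0) := by
    refine tendsto_mul_exp (hlim.congr' ?_) (by linarith)
    filter_upwards [eventually_log_natCast_pos] with n hn
    field_simp
  simpa using (h.rexp).sub_const 1

lemma tendsto_div_sub_mul_div_log
    (hm : Tendsto (fun n : ℕ => m n / (n * log n)) atTop (𝓝 a)) :
    Tendsto (fun n : ℕ => m n / (n.choose 2 - m n - n + 2) * n / log n) atTop (𝓝 (2 * a)) := by
  have hrest : Tendsto (fun n : ℕ => 1 - density n (m n + n) +
      2 / n * ((n : ℝ) ^ 2 / n.choose 2) * (1 / n)) atTop (𝓝 (1 - 0 + 0 * 2 * 0)) :=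
    ((tendsto_density (tendsto_add_self_div_mul_log hm)).const_sub 1).add
      (((tendsto_const_div_natCast 2).mul tendsto_sq_div_choose_two).mul
        (tendsto_const_div_natCast 1))
  have h := (tendsto_density_mul_div_log hm).div hrest (by norm_num)
  simp only [sub_zero, mul_zero, add_zero, div_one] at h
  refine h.congr' ?_
  filter_upwards [eventually_ge_atTop 2] with n hn
  have hN : (0 : ℝ) < n.choose 2 := by exact_mod_cast Nat.choose_pos hn
  have : (0 : ℝ) < n := by exact_mod_cast two_pos.trans_le hn
  have hfactor : 1 - density n (m n + n) + 2 / n * ((n : ℝ) ^ 2 / n.choose 2) * (1 / n) =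
      (n.choose 2 - m n - n + 2) / n.choose 2 := by
    rw [density]
    push_cast
    field_simp
    ring
  rw [Pi.div_apply, hfactor, density]
  field_simp

lemma tendsto_isolated_bound (hm : Tendsto (fun n : ℕ => m n / (n * log n)) atTop (𝓝 a))
    (ha : 2 * a < 1) :
    Tendsto (fun n : ℕ => exp (m n / (n.choose 2 - m n - n + 2) * n) / n +
      m n / (n.choose 2 - m n - n + 2)) atTop (𝓝 0) := by
  have hs := tendsto_div_sub_mul_div_log hm
  have hs0 : Tendsto (fun n : ℕ => m n / (n.choose 2 - m n - n + 2 : ℝ)) atTop (𝓝 0) := by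
    have h := hs.mul tendsto_log_div_natCast
    rw [mul_zero] at h
    refine h.congr' ?_
    filter_upwards [eventually_log_natCast_pos, eventually_gt_atTop 0] with n hn hn0
    field_simp
  have hexponent : Tendsto (fun n : ℕ =>
      (m n / (n.choose 2 - m n - n + 2) * n - (log n + log n)) / log n) atTop
      (𝓝 (2 * a - 2)) := by
    refine (hs.sub_const 2).congr' ?_
    filter_upwards [eventually_log_natCast_pos] with n hn
    rw [sub_div, ← two_mul, mul_div_cancel_right₀ _ hn.ne']
  have hexp := tendsto_mul_exp hexponent (by linarith)
  have h := hexp.add hs0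
  rw [add_zero] at h
  refine h.congr' ?_
  filter_upwards [eventually_gt_atTop 0] with n hn
  have hn' : (0 : ℝ) < n := by exact_mod_cast hn
  rw [exp_sub, exp_add, exp_log hn']
  field_simp

end Asymptotics

section WithHighProbability

open Filter Topology Real

/-- The property `A` of a point set and a random order of its distances holds with probability
tending to `1`, uniformly over all sets of `n` points, as `n → ∞`. -/
def Whp (A : ∀ V : Finset ℝ, RevealOrder V → Prop) : Prop :=
  ∀ ε : ℝ, 0 < ε → ∀ᶠ n in atTop, ∀ V : Finset ℝ, #V = n →
    (uniformOrder V).real {σ | ¬ A V σ} ≤ ε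

section Whp

variable {A B : ∀ V : Finset ℝ, RevealOrder V → Prop}

lemma Whp.of_tendsto {b : ℕ → ℝ} (hb : Tendsto b atTop (𝓝 0))
    (hA : ∀ᶠ n in atTop, ∀ V : Finset ℝ, #V = n → (uniformOrder V).real {σ | ¬ A V σ} ≤ b n) :
    Whp A := by
  intro ε hε
  filter_upwards [hA, hb.eventually_le_const hε] with n hn hbn V hV
  exact (hn V hV).trans hbn

lemma Whp.mono (hA : Whp A)
    (h : ∀ᶠ n in atTop, ∀ V : Finset ℝ, #V = n → ∀ σ, A V σ → B V σ) : Whp B := by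
  intro ε hε
  filter_upwards [hA ε hε, h] with n hn hAB V hV
  exact (measureReal_mono (Set.compl_subset_compl.2 (hAB V hV))).trans (hn V hV)

lemma Whp.and (hA : Whp A) (hB : Whp B) : Whp fun V σ => A V σ ∧ B V σ := by
  intro ε hε
  filter_upwards [hA (ε / 2) (half_pos hε), hB (ε / 2) (half_pos hε)] with n hAn hBn V hV
  calc (uniformOrder V).real {σ | ¬ (A V σ ∧ B V σ)}
      = (uniformOrder V).real ({σ | ¬ A V σ} ∪ {σ | ¬ B V σ}) := by
        simp only [not_and_or, Set.ofPred_or]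
    _ ≤ (uniformOrder V).real {σ | ¬ A V σ} + (uniformOrder V).real {σ | ¬ B V σ} :=
        measureReal_union_le _ _
    _ ≤ ε := by linarith [hAn V hV, hBn V hV]

lemma Whp.exists_forall_le_measureReal (hA : Whp A) {ε : ℝ} (hε : 0 < ε) :
    ∃ N, ∀ V : Finset ℝ, N ≤ #V → 1 - ε ≤ (uniformOrder V).real {σ | A V σ} := by
  obtain ⟨N, hN⟩ := eventually_atTop.1 (hA ε hε)
  refine ⟨N, fun V hV => ?_⟩
  have h : (uniformOrder V).real {σ | ¬ A V σ} = 1 - (uniformOrder V).real {σ | A V σ} :=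
    probReal_compl_eq_one_sub .of_discrete
  linarith [hN #V hV V rfl]

end Whp

variable {m m₁ m₂ : ℕ → ℕ} {a a₁ a₂ : ℝ}

lemma whp_exists_neighborSet_eq_empty
    (hm : Tendsto (fun n : ℕ => m n / (n * log n)) atTop (𝓝 a)) (ha : a < 1 / 2) :
    Whp fun V σ => ∃ u, (revealedGraph σ (m #V)).neighborSet u = ∅ := by
  refine .of_tendsto (tendsto_isolated_bound hm (by linarith)) ?_
  filter_upwards [eventually_le_choose_two (tendsto_add_self_div_mul_log hm),
    eventually_ge_atTop 2] with n hmn hn V hV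
  subst hV
  exact measureReal_not_exists_neighborSet_eq_empty_le hn hmn

lemma exists_one_lt_one_sub_exp_neg_mul {b : ℝ} (hb : 1 < b) :
    ∃ θ, 0 ≤ θ ∧ 1 < (1 - exp (-θ)) * b := by
  have h : Tendsto (fun θ => (1 - exp (-θ)) * b) atTop (𝓝 ((1 - 0) * b)) :=
    (tendsto_exp_neg_atTop_nhds_zero.const_sub 1).mul_const b
  exact ((eventually_ge_atTop 0).and (h.eventually_const_lt (by linarith))).exists

lemma whp_lowDegree_one_eq_empty
    (hm : Tendsto (fun n : ℕ => m n / (n * log n)) atTop (𝓝 a)) (ha : 1 / 2 < a) :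
    Whp fun V σ => lowDegree (revealedGraph σ (m #V)) 1 = ∅ := by
  obtain ⟨θ, hθ, haθ⟩ := exists_one_lt_one_sub_exp_neg_mul (b := 2 * a) (by linarith)
  refine .of_tendsto (tendsto_lowDegree_one_bound hm haθ) ?_
  filter_upwards [eventually_le_choose_two hm] with n hmn V hV
  subst hV
  simpa only [← Set.nonempty_iff_ne_empty] using measureReal_lowDegree_one_nonempty_le hmn hθ

lemma whp_largeSetsJoined {β : ℝ}
    (hm : Tendsto (fun n : ℕ => m n / (n * log n)) atTop (𝓝 a)) (ha : 0 < a) (hβ : 0 < β) :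
    Whp fun V σ => LargeSetsJoined (revealedGraph σ (m #V)) (β * #V) := by
  refine .of_tendsto (tendsto_largeSetsJoined_bound hm ha hβ) ?_
  filter_upwards [eventually_le_choose_two hm] with n hmn V hV
  subst hV
  exact measureReal_not_largeSetsJoined_le hmn (by positivity)

lemma eventually_whp_smallSetsSparse {δ : ℝ}
    (hm : Tendsto (fun n : ℕ => m n / (n * log n)) atTop (𝓝 a)) (hδ : 0 < δ) :
    ∀ᶠ β in 𝓝 0, Whp fun V σ =>
      SmallSetsSparse (revealedGraph σ (m #V)) (2 * (β * #V)) (δ * log #V - 2) := by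
  set θ := 4 / δ
  have hβ : ∀ᶠ β in 𝓝 0, 1 + (exp θ - 1) * (2 * a) * (2 * β) < θ * δ / 2 := by
    refine (Continuous.tendsto (by fun_prop) 0).eventually_lt_const ?_
    rw [div_mul_cancel₀ _ hδ.ne']
    norm_num
  filter_upwards [hβ] with β hβ
  refine .of_tendsto (tendsto_smallSetsSparse_bound hm hβ) (.of_forall fun n V hV => ?_)
  subst hV
  exact measureReal_not_smallSetsSparse_le _ _ (by positivity)

lemma exists_whp_lowDegree (hm₁ : Tendsto (fun n : ℕ => m₁ n / (n * log n)) atTop (𝓝 a₁))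
    (hm₂ : Tendsto (fun n : ℕ => m₂ n / (n * log n)) atTop (𝓝 a₂)) (ha₁ : 1 / 4 < a₁) :
    ∃ δ, 0 < δ ∧
      Whp (fun V σ => (revealedGraph σ (m₂ #V)).IsIndepSet
        (lowDegree (revealedGraph σ (m₁ #V)) (δ * log #V))) ∧
      Whp (fun V σ => (lowDegree (revealedGraph σ (m₁ #V)) (δ * log #V)).PairwiseDisjoint
        (revealedGraph σ (m₂ #V)).neighborSet) ∧
      Whp (fun V σ => ReflectionFree (revealedGraph σ (m₂ #V))
        (lowDegree (revealedGraph σ (m₁ #V)) (δ * log #V))) := by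
  obtain ⟨θ, hθ, haθ⟩ := exists_one_lt_one_sub_exp_neg_mul (b := 4 * a₁) (by linarith)
  have hδ : ∀ᶠ δ in 𝓝[>] 0, 1 + 2 * θ * δ < (1 - exp (-θ)) * (4 * a₁) := by
    refine nhdsWithin_le_nhds ((Continuous.tendsto (by fun_prop) 0).eventually_lt_const ?_)
    linarith
  obtain ⟨δ, haδ, hδ⟩ := (hδ.and self_mem_nhdsWithin).exists
  have hbound := tendsto_lowPair_bound hm₁ hm₂ haδ
  have hm := (eventually_le_choose_two hm₁).and (eventually_two_le hm₁ (by linarith))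
  refine ⟨δ, hδ, .of_tendsto (hbound 1) ?_, .of_tendsto (hbound 2) ?_, .of_tendsto (hbound 1) ?_⟩
  all_goals filter_upwards [hm] with n ⟨hle, hge⟩ V hV; subst hV
  · exact measureReal_not_isIndepSet_le hge hle hθ _
  · exact measureReal_not_pairwiseDisjoint_le hge hle hθ _
  · exact measureReal_not_reflectionFree_le hge hle hθ _

lemma exists_whp_pseudorandom (hm₁ : Tendsto (fun n : ℕ => m₁ n / (n * log n)) atTop (𝓝 a₁))
    (hm₂ : Tendsto (fun n : ℕ => m₂ n / (n * log n)) atTop (𝓝 a₂)) (ha₁ : 1 / 4 < a₁) :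
    ∃ β δ, 0 < β ∧ β < 1 / 6 ∧ Whp fun V σ => Pseudorandom V (revealedGraph σ (m₁ #V))
      (revealedGraph σ (m₂ #V)) (β * #V) (δ * log #V - 2) := by
  obtain ⟨δ, hδ, hindep, hdisj, hrefl⟩ := exists_whp_lowDegree hm₁ hm₂ ha₁
  have hsmall : ∀ᶠ β : ℝ in 𝓝[>] 0, β ∈ Set.Ioo 0 (1 / 6) := Ioo_mem_nhdsGT (by norm_num)
  obtain ⟨β, ⟨hβ0, hβ6⟩, hsparse⟩ := (hsmall.and
    (nhdsWithin_le_nhds (eventually_whp_smallSetsSparse hm₂ hδ))).exists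
  have hjoined := whp_largeSetsJoined hm₁ (by linarith) hβ0
  refine ⟨β, δ, hβ0, hβ6, (hjoined.and (hsparse.and (hindep.and (hdisj.and hrefl)))).mono ?_⟩
  refine .of_forall fun n V _ σ ⟨hj, hs, hi, hd, hr⟩ => ?_
  exact ⟨hj, hs, by rwa [sub_add_cancel], by rwa [sub_add_cancel], by rwa [sub_add_cancel]⟩

lemma tendsto_floor_mul_div {a : ℝ} (ha : 0 ≤ a) :
    Tendsto (fun n : ℕ => (⌊a * (n * log n)⌋₊ : ℝ) / (n * log n)) atTop (𝓝 a) :=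
  (tendsto_nat_floor_mul_div_atTop ha).comp
    (tendsto_natCast_atTop_atTop.atTop_mul_atTop₀ tendsto_log_natCast_atTop)

end WithHighProbability

end LineReconstruction

open LineReconstruction in
theorem theorem1p3 :
    ∀ ε : ℝ, 0 < ε → ∃ N : ℕ, ∀ V : Finset ℝ, N ≤ V.card →
      1 - ε ≤ (ProbabilityTheory.uniformOn (Set.univ : Set (RevealOrder V))).real
        {σ : RevealOrder V | ∃ t : ℕ,
          IsLeast {s : ℕ | NoIsolatedNoUndecidable V (revealedGraph σ s)} t ∧
          IsLeast {s : ℕ | Reconstructible V (revealedGraph σ s)} t} := by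
  intro ε hε
  have hm₁ := tendsto_floor_mul_div (a := 1 / 3) (by norm_num)
  have hm₂ := tendsto_floor_mul_div zero_le_one
  have hearly := whp_exists_neighborSet_eq_empty hm₁ (by norm_num)
  have hlate := whp_lowDegree_one_eq_empty hm₂ (by norm_num)
  obtain ⟨β, δ, hβ0, hβ6, hpseudo⟩ := exists_whp_pseudorandom hm₁ hm₂ (by norm_num)
  have hagree : Whp fun _ σ => HittingTimesAgree σ := by
    refine (hearly.and (hlate.and hpseudo)).mono ?_
    filter_upwards [Filter.eventually_ge_atTop 3] with n hn V hV σ ⟨he, hl, hp⟩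
    have hn' : (0 : ℝ) < V.card := by exact_mod_cast (by omega : 0 < V.card)
    exact hittingTimesAgree_of_pseudorandom (hV ▸ hn) (by positivity) (by nlinarith) he hl hp
  exact hagree.exists_forall_le_measureReal hε
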